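/- For a measurable real function $f$ on $[0,1]$ let $f^*(t)=\inf\{s\ge 0:\operatorname{mes}\{|f|>s\}\le t\}$ be the decreasing rearrangement of $|f|$. A nonzero Banach space $E$ of (classes of) measurable real functions on $[0,1]$ is called rearrangement invariant (r.i.) if $g\in E$ and $f^*\le g^*$ imply $f\in E$ and $\|f\|_E\le\|g\|_E$. For a real $n\times n$ matrix $x=(x_{ij})$, $n\ge 1$, let $x_1^*\ge x_2^*\ge\dots\ge x_{n^2}^*$ be the numbers $|x_{ij}|$ in decreasing order, put $$Ux=\sum_{k=1}^n x_k^*\,\chi_{((k-1)/n,\,k/n)},$$ and, for $1\le q<\infty$ and a fixed bijection $\ell$ (one for each $n$) from the set $S_n$ of permutations of $\{1,\dots,n\}$ onto $\{1,\dots,n!\}$, put $$T_qx(t)=\Big(\sum_{i=1}^n|x_{i,\pi(i)}|^q\Big)^{1/q},\qquad t\in\Big[\tfrac{\ell(\pi)-1}{n!},\tfrac{\ell(\pi)}{n!}\Big),\ \pi\in S_n .$$ Let $E$ be an r.i. space on $[0,1]$ and let $1\le q<\infty$. Then the following are equivalent. (a) There are constants $c,C>0$, independent of $n$ and $x$, such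 that for all $n\ge1$ and all real $n\times n$ matrices $x$ $$c\Big(\|Ux\|_E+\Big(\frac1n\sum_{k=n+1}^{n^2}(x_k^*)^q\Big)^{1/q}\Big)\le\|T_qx\|_E\le C\Big(\|Ux\|_E+\Big(\frac1n\sum_{k=n+1}^{n^2}(x_k^*)^q\Big)^{1/q}\Big).$$ (b) There is a constant $C$, independent of $n$ and $y$, such that $\|T_qy\|_E\le C\|Uy\|_E$ for all $n\ge1$ and all diagonal real $n\times n$ matrices $y$. -/

import Mathlib

open MeasureTheory Filter Topology
open scoped ENNReal NNReal Nat

noncomputable section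

/-- Lebesgue measure on the interval `[0,1]`. -/
abbrev unitMeasure : Measure ℝ := volume.restrict (Set.Icc (0 : ℝ) 1)

/-- Measurable real functions on `[0,1]`, modulo equality almost everywhere. -/
abbrev UnitFun : Type := ℝ →ₘ[unitMeasure] ℝ

/-- The decreasing rearrangement `f^*` of `|f|`, that is
`f^*(t) = inf {s ≥ 0 : mes {|f| > s} ≤ t}`. The value at `t = 0` is the essential supremum
of `|f|`, possibly `∞`; the values at `t > 0` are finite. -/
def decRearr (f : UnitFun) (t : ℝ) : ℝ≥0∞ :=
  sInf {s : ℝ≥0∞ | unitMeasure {u : ℝ | s < ‖f u‖ₑ} ≤ ENNReal.ofReal t}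

/-- A (nonzero) rearrangement invariant Banach function space `E` on `[0,1]`, given by its norm.
The norm is extended by the value `∞` to the measurable functions outside `E`, so that
`E = {f : ‖f‖_E < ∞}`. -/
structure RISpace where
  /-- The norm of `E`, equal to `∞` outside `E`. -/
  nrm : UnitFun → ℝ≥0∞
  nrm_eq_zero_iff : ∀ f, nrm f = 0 ↔ f = 0
  nrm_add_le : ∀ f g, nrm (f + g) ≤ nrm f + nrm g
  nrm_smul : ∀ (c : ℝ) (f), nrm (c • f) = ‖c‖ₑ * nrm f
  /-- The constant function `1` belongs to `E`. -/
  nrm_one_lt_top : nrm 1 < ∞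
  /-- `E` is complete: every Cauchy sequence of elements of `E` converges in `E`. -/
  complete : ∀ u : ℕ → UnitFun, (∀ n, nrm (u n) < ∞) →
    (∀ ε : ℝ≥0∞, 0 < ε → ∃ N, ∀ m ≥ N, ∀ n ≥ N, nrm (u m - u n) < ε) →
    ∃ f, nrm f < ∞ ∧ Tendsto (fun n => nrm (u n - f)) atTop (𝓝 0)
  /-- If `g ∈ E` and `f^* ≤ g^*`, then `f ∈ E` and `‖f‖_E ≤ ‖g‖_E`. -/
  nrm_le_of_decRearr_le : ∀ f g,
    (∀ t ∈ Set.Icc (0 : ℝ) 1, decRearr f t ≤ decRearr g t) → nrm f ≤ nrm g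

/-- `x_1^* ≥ x_2^* ≥ … ≥ x_{n²}^*`, the numbers `|x_{ij}|` in decreasing order
(`k` runs from `1` to `n²`). -/
def entryRearr {n : ℕ} (x : Matrix (Fin n) (Fin n) ℝ) (k : ℕ) : ℝ :=
  (((Finset.univ : Finset (Fin n × Fin n)).val.map fun p => |x p.1 p.2|).sort (· ≥ ·)).getD
    (k - 1) 0

/-- The function `∑_π (∑_i |x_{i,π(i)}|^q)^{1/q} χ_{[(ℓ(π)-1)/n!, ℓ(π)/n!)}`; the bijection `ℓ`
is indexed from `0` here. -/
def opTFun {n : ℕ} (ℓ : Equiv.Perm (Fin n) ≃ Fin n !) (q : ℝ) (x : Matrix (Fin n) (Fin n) ℝ) :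
    ℝ → ℝ := fun t =>
  ∑ π : Equiv.Perm (Fin n),
    (Set.Ico (((ℓ π : ℕ) : ℝ) / (n ! : ℝ)) ((((ℓ π : ℕ) : ℝ) + 1) / (n ! : ℝ))).indicator
      (fun _ => (∑ i, |x i (π i)| ^ q) ^ (1 / q)) t

/-- The function `∑_{k=1}^n x_k^* χ_{((k-1)/n, k/n)}`. -/
def opUFun {n : ℕ} (x : Matrix (Fin n) (Fin n) ℝ) : ℝ → ℝ := fun t =>
  ∑ k ∈ Finset.Icc 1 n,
    (Set.Ioo (((k : ℝ) - 1) / (n : ℝ)) ((k : ℝ) / (n : ℝ))).indicator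
      (fun _ => entryRearr x k) t

theorem measurable_opTFun {n : ℕ} (ℓ : Equiv.Perm (Fin n) ≃ Fin n !) (q : ℝ)
    (x : Matrix (Fin n) (Fin n) ℝ) : Measurable (opTFun ℓ q x) :=
  Finset.measurable_sum _ fun _ _ => measurable_const.indicator measurableSet_Ico

theorem measurable_opUFun {n : ℕ} (x : Matrix (Fin n) (Fin n) ℝ) : Measurable (opUFun x) :=
  Finset.measurable_sum _ fun _ _ => measurable_const.indicator measurableSet_Ioo

/-- The operator `T_q` (for `q < ∞`, with respect to the enumeration `ℓ` of the permutations). -/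
def opT {n : ℕ} (ℓ : Equiv.Perm (Fin n) ≃ Fin n !) (q : ℝ) (x : Matrix (Fin n) (Fin n) ℝ) :
    UnitFun :=
  AEEqFun.mk (opTFun ℓ q x) (measurable_opTFun ℓ q x).aestronglyMeasurable

/-- The operator `U`. -/
def opU {n : ℕ} (x : Matrix (Fin n) (Fin n) ℝ) : UnitFun :=
  AEEqFun.mk (opUFun x) (measurable_opUFun x).aestronglyMeasurable

/-- The tail term `((1/n) ∑_{k=n+1}^{n²} (x_k^*)^q)^{1/q}`. -/
def tailTerm {n : ℕ} (q : ℝ) (x : Matrix (Fin n) (Fin n) ℝ) : ℝ :=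
  ((1 / (n : ℝ)) * ∑ k ∈ Finset.Icc (n + 1) (n ^ 2), entryRearr x k ^ q) ^ (1 / q)

end

/-! Everything is computed for a uniformly random permutation `π`: `T_q x` has the distribution of
the `ℓ_q` norm of `x` along the graph of `π`. In an r.i. space, if the distribution function of `f`
is at most an integer `c` times that of `g`, then the norm of `f` is at most `c` times that of `g`
(`nrm_stepFun_le_mul`). Norm estimates thus reduce to counting permutations.

The lower estimate in (a) holds in every r.i. space. A second moment argument (`le_sum_perm_sub_sq`)
shows that `π` meets a set of `m ≤ n` positions with probability at least `m / (4n)`, which bounds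
`U x`. Applied to the entries truncated at `x_n^*`, it bounds the mean of `T_q x` below by a quarter
of the tail term, and the mean times the norm of `1` is at most the norm.

For the upper estimate, given (b), split the entries in decreasing order into two blocks of at most
`(n+1)/2` entries each, followed by the entries beyond the `n`-th. A block of that size can be moved
injectively to the diagonal: the probability that `π` hits a prescribed set of positions is at most
three times the probability that the corresponding diagonal positions are exactly the ones hit
(`card_perm_hit_sum_le`), so (b) controls both blocks. The remaining entries are at most `x_n^*`.
After rescaling to entries in `[0,1]` with total `q`-sum at most `n`, a Markov bound for elementary
symmetric functions compares the tail of the sum along `π` with that of the number of fixed points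
in a set of about `n/2` indices (`card_perm_sum_ge_le`). That number comes from a 0-1 diagonal
matrix, to which (b) applies again.

Conversely, a diagonal matrix has at most `n` nonzero entries, so its tail term vanishes and (a)
contains (b). -/

/-! ### Step functions on equal intervals and their distribution -/

/-- The function `t ↦ w ⌊N t⌋` on `[0,1]`, constant on `N` intervals of equal length. -/
noncomputable def stepFun (N : ℕ) (w : ℕ → ℝ) : UnitFun :=
  AEEqFun.mk (fun t : ℝ => w ⌊(N : ℝ) * t⌋₊)
    ((measurable_from_nat.comp (Nat.measurable_floor.comp
      (measurable_const.mul measurable_id))).aestronglyMeasurable)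

theorem coeFn_stepFun (N : ℕ) (w : ℕ → ℝ) :
    stepFun N w =ᵐ[unitMeasure] fun t : ℝ => w ⌊(N : ℝ) * t⌋₊ :=
  AEEqFun.coeFn_mk _ _

theorem ae_unitMeasure_of_Ico {p : ℝ → Prop} (h : ∀ t ∈ Set.Ico (0 : ℝ) 1, p t) :
    ∀ᵐ t ∂unitMeasure, p t := by
  rw [unitMeasure, ← Measure.restrict_congr_set Ico_ae_eq_Icc]
  filter_upwards [ae_restrict_mem measurableSet_Ico] with t ht using h t ht

theorem stepFun_add (N : ℕ) (w z : ℕ → ℝ) : stepFun N (w + z) = stepFun N w + stepFun N z := rfl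

theorem stepFun_smul (N : ℕ) (c : ℝ) (w : ℕ → ℝ) : stepFun N (c • w) = c • stepFun N w := rfl

theorem stepFun_one (N : ℕ) : stepFun N 1 = 1 := rfl

theorem stepFun_zero (N : ℕ) : stepFun N 0 = 0 := rfl

theorem stepFun_sum {ι : Type*} (N : ℕ) (s : Finset ι) (w : ι → ℕ → ℝ) :
    stepFun N (∑ i ∈ s, w i) = ∑ i ∈ s, stepFun N (w i) := by
  classical
  induction s using Finset.induction_on with
  | empty => simp [stepFun_zero]
  | insert a s ha ih => rw [Finset.sum_insert ha, Finset.sum_insert ha, stepFun_add, ih]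

theorem stepFun_refine (N d : ℕ) (hd : 0 < d) (w : ℕ → ℝ) :
    stepFun (N * d) (fun k => w (k / d)) = stepFun N w := by
  refine AEEqFun.mk_eq_mk.2 (Eventually.of_forall fun t => ?_)
  have hd' : (d : ℝ) ≠ 0 := by positivity
  simp only
  rw [← Nat.floor_div_natCast]
  congr 2
  push_cast
  field_simp

theorem volume_preimage_floor (N : ℕ) (hN : 0 < N) (A : Finset ℕ) (hA : A ⊆ Finset.range N) :
    unitMeasure {t : ℝ | ⌊(N : ℝ) * t⌋₊ ∈ A} = (A.card : ℝ≥0∞) / N := by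
  have hN' : (0 : ℝ) < N := by positivity
  rw [unitMeasure, ← Measure.restrict_congr_set Ico_ae_eq_Icc]
  have hm : Measurable fun t : ℝ => ⌊(N : ℝ) * t⌋₊ :=
    Nat.measurable_floor.comp (measurable_const.mul measurable_id)
  have hmA : MeasurableSet {t : ℝ | ⌊(N : ℝ) * t⌋₊ ∈ A} :=
    hm (MeasurableSet.of_discrete (s := (A : Set ℕ)))
  rw [Measure.restrict_apply hmA]
  have : {t : ℝ | ⌊(N : ℝ) * t⌋₊ ∈ A} ∩ Set.Ico 0 1 =
      ⋃ k ∈ A, Set.Ico ((k : ℝ) / N) ((k + 1 : ℝ) / N) := by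
    ext t
    simp only [Set.mem_inter_iff, Set.mem_ofPred_eq, Set.mem_Ico, Set.mem_iUnion, exists_prop,
      div_le_iff₀ hN', lt_div_iff₀ hN']
    constructor
    · rintro ⟨h, h0, h1⟩
      refine ⟨_, h, ?_⟩
      rw [mul_comm t]
      exact ⟨Nat.floor_le (by positivity), Nat.lt_floor_add_one _⟩
    · rintro ⟨k, hk, h1, h2⟩
      have ht : 0 ≤ t := by
        have : 0 ≤ t * N := le_trans (by positivity) h1
        exact nonneg_of_mul_nonneg_left this hN'
      have : ⌊(N : ℝ) * t⌋₊ = k := by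
        rw [mul_comm, Nat.floor_eq_iff (by positivity)]
        exact ⟨h1, h2⟩
      refine ⟨this ▸ hk, ht, ?_⟩
      have hkN : (k : ℝ) + 1 ≤ N := by exact_mod_cast Finset.mem_range.1 (hA hk)
      by_contra! h
      nlinarith
  rw [this, measure_biUnion_finset]
  · have : ∀ k ∈ A, volume (Set.Ico ((k : ℝ) / N) ((k + 1 : ℝ) / N)) = (N : ℝ≥0∞)⁻¹ := by
      intro k _
      rw [Real.volume_Ico, ← sub_div, add_sub_cancel_left, one_div,
        ENNReal.ofReal_inv_of_pos hN', ENNReal.ofReal_natCast]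
    rw [Finset.sum_congr rfl this]
    simp [div_eq_mul_inv]
  · intro i _ j _ hij
    rw [Function.onFun, Set.disjoint_left]
    rintro t ⟨h1, h2⟩ ⟨h3, h4⟩
    rw [div_le_iff₀ hN'] at h1 h3
    rw [lt_div_iff₀ hN'] at h2 h4
    have a : (i : ℝ) < j + 1 := by linarith
    have b : (j : ℝ) < i + 1 := by linarith
    norm_cast at a b
    omega
  · intro _ _
    exact measurableSet_Ico

theorem distribution_stepFun (N : ℕ) (hN : 0 < N) (w : ℕ → ℝ) (s : ℝ≥0∞) :
    unitMeasure {t : ℝ | s < ‖stepFun N w t‖ₑ} =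
      (((Finset.range N).filter fun k => s < ‖w k‖ₑ).card : ℝ≥0∞) / N := by
  rw [← volume_preimage_floor N hN _ (Finset.filter_subset _ _)]
  have h1 : ∀ᵐ t ∂unitMeasure, ⌊(N : ℝ) * t⌋₊ < N := by
    refine ae_unitMeasure_of_Ico fun t ht => ?_
    have hN' : (0 : ℝ) < N := by positivity
    rw [Nat.floor_lt (mul_nonneg hN'.le ht.1)]
    nlinarith [ht.2]
  apply measure_congr
  filter_upwards [coeFn_stepFun N w, h1] with t ht ht1
  apply propext
  change (s < ‖stepFun N w t‖ₑ) ↔ (⌊(N : ℝ) * t⌋₊ ∈ _)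
  rw [ht]
  simp [ht1]

/-! ### Comparison of norms in an r.i. space by counting steps -/

namespace RISpace

variable (E : RISpace)

theorem nrm_le_of_distribution_le {f g : UnitFun}
    (h : ∀ s : ℝ≥0∞, unitMeasure {u : ℝ | s < ‖f u‖ₑ} ≤ unitMeasure {u : ℝ | s < ‖g u‖ₑ}) :
    E.nrm f ≤ E.nrm g :=
  E.nrm_le_of_decRearr_le f g fun _ _ => sInf_le_sInf fun s hs => (h s).trans hs

theorem nrm_zero : E.nrm 0 = 0 := (E.nrm_eq_zero_iff 0).2 rfl

theorem nrm_sum_le {ι : Type*} (s : Finset ι) (f : ι → UnitFun) :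
    E.nrm (∑ i ∈ s, f i) ≤ ∑ i ∈ s, E.nrm (f i) :=
  Finset.le_sum_of_subadditive E.nrm E.nrm_zero.le E.nrm_add_le s f

theorem nrm_one_ne_zero : E.nrm 1 ≠ 0 := by
  intro h
  have h1 := (E.nrm_eq_zero_iff 1).1 h
  have h2 : (1 : UnitFun) =ᵐ[unitMeasure] (0 : UnitFun) := by rw [h1]
  have h3 : ∀ᵐ _ ∂unitMeasure, False := by
    filter_upwards [h2, AEEqFun.coeFn_one (α := ℝ) (μ := unitMeasure) (β := ℝ),
      AEEqFun.coeFn_zero (α := ℝ) (μ := unitMeasure) (β := ℝ)] with t h h1 h0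
    rw [h1, h0] at h
    simp at h
  rw [ae_iff] at h3
  simp at h3

/-- The hypothesis compares the two distribution functions after clearing the denominators `N` and
`M`, so step functions on different grids can be compared by counting. -/
theorem nrm_stepFun_le_of_card_le {N M : ℕ} (hN : 0 < N) (hM : 0 < M) {w z : ℕ → ℝ}
    (h : ∀ s : ℝ, 0 ≤ s → ((Finset.range N).filter fun k => s < |w k|).card * M ≤
      ((Finset.range M).filter fun k => s < |z k|).card * N) :
    E.nrm (stepFun N w) ≤ E.nrm (stepFun M z) := by
  refine E.nrm_le_of_distribution_le fun s => ?_
  rw [distribution_stepFun N hN, distribution_stepFun M hM]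
  by_cases hs : s = ∞
  · simp [hs]
  · lift s to ℝ≥0 using hs
    have e : ∀ a : ℝ, ((s : ℝ≥0∞) < ‖a‖ₑ) ↔ (s : ℝ) < |a| := by
      intro a
      rw [← ofReal_norm, Real.norm_eq_abs, ← ENNReal.ofReal_coe_nnreal,
        ENNReal.ofReal_lt_ofReal_iff_of_nonneg (NNReal.coe_nonneg s)]
    simp only [e]
    rw [ENNReal.div_le_iff (by positivity) (by simp), div_eq_mul_inv, mul_right_comm,
      ← div_eq_mul_inv, ENNReal.le_div_iff_mul_le (by simp [hM.ne']) (by simp)]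
    have := h s s.2
    exact_mod_cast this

theorem card_filter_range_mul_mod {N d j : ℕ} (hj : j < d) (p : ℕ → Prop) [DecidablePred p] :
    ((Finset.range (N * d)).filter fun k => k % d = j ∧ p (k / d)).card =
      ((Finset.range N).filter p).card := by
  refine (Finset.card_bij (fun k _ => k * d + j) ?_ ?_ ?_).symm
  · intro k hk
    simp only [Finset.mem_filter, Finset.mem_range] at hk ⊢
    have h1 : (k * d + j) / d = k := by
      rw [mul_comm, Nat.mul_add_div (by omega), Nat.div_eq_of_lt hj, add_zero]
    refine ⟨by nlinarith [hk.1], by rw [mul_comm, Nat.mul_add_mod, Nat.mod_eq_of_lt hj], ?_⟩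
    rw [h1]
    exact hk.2
  · intro a _ b _ hab
    have hd : 0 < d := by omega
    exact Nat.eq_of_mul_eq_mul_right hd (by omega)
  · intro k hk
    simp only [Finset.mem_filter, Finset.mem_range] at hk
    refine ⟨k / d, ?_, ?_⟩
    · simp only [Finset.mem_filter, Finset.mem_range]
      exact ⟨Nat.div_lt_of_lt_mul (by rw [mul_comm]; exact hk.1), hk.2.2⟩
    · rw [← hk.2.1, mul_comm, Nat.div_add_mod]

/-- Cut each interval into `c` pieces and let the `j`-th summand keep only the `j`-th piece of every
interval. Each of the `c` summands has `1/c` of the original distribution function, so the triangle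
inequality costs a factor `c`. -/
theorem nrm_stepFun_le_mul {N M : ℕ} (hN : 0 < N) (hM : 0 < M) {w z : ℕ → ℝ} {c : ℕ} (hc : 0 < c)
    (h : ∀ s : ℝ, 0 ≤ s → ((Finset.range N).filter fun k => s < |w k|).card * M ≤
      c * (((Finset.range M).filter fun k => s < |z k|).card * N)) :
    E.nrm (stepFun N w) ≤ c * E.nrm (stepFun M z) := by
  have h1 : (fun k => w (k / c)) =
      ∑ j ∈ Finset.range c, fun k => if k % c = j then w (k / c) else 0 := by
    ext k
    rw [Finset.sum_apply, Finset.sum_ite_eq, if_pos (Finset.mem_range.2 (Nat.mod_lt _ hc))]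
  rw [← stepFun_refine N c hc, h1, stepFun_sum]
  refine (E.nrm_sum_le _ _).trans ?_
  have h2 : ∀ j ∈ Finset.range c,
      E.nrm (stepFun (N * c) fun k => if k % c = j then w (k / c) else 0) ≤
        E.nrm (stepFun M z) := by
    intro j hj
    refine E.nrm_stepFun_le_of_card_le (by positivity) hM fun s hs => ?_
    have : ((Finset.range (N * c)).filter fun k => s < |if k % c = j then w (k / c) else 0|) =
        (Finset.range (N * c)).filter fun k => k % c = j ∧ s < |w (k / c)| := by
      refine Finset.filter_congr fun k _ => ?_
      split_ifs with hk <;> simp [hk, hs]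
    rw [this, card_filter_range_mul_mod (Finset.mem_range.1 hj) fun k => s < |w k|]
    calc _ ≤ _ := h s hs
      _ = _ := by ring
  refine (Finset.sum_le_sum h2).trans ?_
  simp

/-- The `N` cyclic shifts of `w` have norm at most that of `w`, and their sum is the constant `∑ w`.
-/
theorem ofReal_mean_mul_nrm_one_le {N : ℕ} (hN : 0 < N) {w : ℕ → ℝ} (hw : ∀ k, 0 ≤ w k) :
    ENNReal.ofReal ((∑ k ∈ Finset.range N, w k) / N) * E.nrm 1 ≤ E.nrm (stepFun N w) := by
  have hN' : (0 : ℝ) < N := by positivity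
  have inj : ∀ c : ℕ, Set.InjOn (fun k => (k + c) % N) (Finset.range N : Set ℕ) := by
    intro c a ha b hb hab
    simp only [Finset.coe_range, Set.mem_Iio] at ha hb
    have : a + c ≡ b + c [MOD N] := hab
    exact Nat.ModEq.eq_of_lt_of_lt (Nat.ModEq.add_right_cancel' c this) ha hb
  have img : ∀ c : ℕ, (Finset.range N).image (fun k => (k + c) % N) = Finset.range N := by
    intro c
    refine Finset.eq_of_subset_of_card_le ?_ ?_
    · intro k hk
      obtain ⟨a, _, rfl⟩ := Finset.mem_image.1 hk
      exact Finset.mem_range.2 (Nat.mod_lt _ hN)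
    · rw [Finset.card_image_of_injOn (inj c)]
  have h1 : ∀ c ∈ Finset.range N,
      E.nrm (stepFun N fun k => w ((k + c) % N)) ≤ E.nrm (stepFun N w) := by
    intro c _
    refine E.nrm_stepFun_le_of_card_le hN hN fun s _ => ?_
    gcongr ?_ * N
    refine Finset.card_le_card_of_injOn (fun k => (k + c) % N) ?_ ?_
    · intro k hk
      simp only [Finset.coe_filter, Set.mem_ofPred_eq, Finset.mem_range] at hk ⊢
      exact ⟨Nat.mod_lt _ hN, hk.2⟩
    · exact (inj c).mono fun k hk => (Finset.mem_filter.1 hk).1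
  have h2 : (∑ c ∈ Finset.range N, fun k => w ((k + c) % N)) =
      (∑ k ∈ Finset.range N, w k) • (1 : ℕ → ℝ) := by
    ext k
    rw [Finset.sum_apply, Pi.smul_apply, Pi.one_apply, smul_eq_mul, mul_one]
    conv_rhs => rw [← img k, Finset.sum_image (inj k)]
    exact Finset.sum_congr rfl fun c _ => by rw [add_comm]
  have h3 := (E.nrm_sum_le (Finset.range N) fun c => stepFun N fun k => w ((k + c) % N)).trans
    (Finset.sum_le_sum h1)
  rw [← stepFun_sum, h2, stepFun_smul, stepFun_one, E.nrm_smul, Finset.sum_const,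
    Finset.card_range, nsmul_eq_mul] at h3
  rw [ENNReal.ofReal_div_of_pos hN', ENNReal.ofReal_natCast,
    ← Real.enorm_of_nonneg (Finset.sum_nonneg fun k _ => hw k), div_eq_mul_inv,
    mul_right_comm, ← div_eq_mul_inv]
  exact ENNReal.div_le_of_le_mul' h3

end RISpace

/-! ### Counting permutations: moments and prescribed values -/

section PermutationCounting

variable {n : ℕ}

theorem card_perm_fixing (I : Finset (Fin n)) :
    (Finset.univ.filter fun π : Equiv.Perm (Fin n) => ∀ i ∈ I, π i = i).card = (n - I.card)! := by
  have h := Fintype.card_congr (Equiv.Perm.subtypeEquivSubtypePerm fun i : Fin n => i ∉ I)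
  rw [Fintype.card_perm, Fintype.card_subtype_compl, Fintype.card_fin, Fintype.card_coe,
    Fintype.card_subtype] at h
  rw [h]
  congr 1
  ext π
  simp

theorem card_perm_agreeing (ρ : Equiv.Perm (Fin n)) (I : Finset (Fin n)) :
    (Finset.univ.filter fun π : Equiv.Perm (Fin n) => ∀ i ∈ I, π i = ρ i).card =
      (n - I.card)! := by
  rw [← card_perm_fixing I]
  refine Finset.card_equiv (Equiv.mulLeft ρ⁻¹) fun π => ?_
  simp [Equiv.symm_apply_eq]

theorem card_perm_agreeing_le (g : Fin n → Fin n) (I : Finset (Fin n)) :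
    (Finset.univ.filter fun π : Equiv.Perm (Fin n) => ∀ i ∈ I, π i = g i).card ≤
      (n - I.card)! := by
  by_cases h : ∃ ρ : Equiv.Perm (Fin n), ∀ i ∈ I, ρ i = g i
  · obtain ⟨ρ, h⟩ := h
    rw [← card_perm_agreeing ρ I]
    refine Finset.card_le_card fun π => ?_
    simp only [Finset.mem_filter, Finset.mem_univ, true_and]
    exact fun h1 i hi => (h1 i hi).trans (h i hi).symm
  · push Not at h
    rw [Finset.card_eq_zero.2]
    · exact Nat.zero_le _
    · refine Finset.filter_eq_empty_iff.2 fun π _ h1 => ?_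
      obtain ⟨i, hi, h2⟩ := h π
      exact h2 (h1 i hi)

/-- If some permutation passes through all of `J`, then the positions in `J` lie in distinct rows,
and `J` prescribes the values at `J.card` points. -/
theorem card_perm_hitting_le (J : Finset (Fin n × Fin n)) :
    (Finset.univ.filter fun π : Equiv.Perm (Fin n) => ∀ p ∈ J, π p.1 = p.2).card ≤
      (n - J.card)! := by
  rcases Finset.eq_empty_or_nonempty
    (Finset.univ.filter fun π : Equiv.Perm (Fin n) => ∀ p ∈ J, π p.1 = p.2) with h | ⟨ρ, hρ⟩
  · rw [h]
    exact Nat.zero_le _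
  · simp only [Finset.mem_filter, Finset.mem_univ, true_and] at hρ
    have hc : (J.image Prod.fst).card = J.card := by
      refine Finset.card_image_of_injOn fun p hp r hr hpr => ?_
      exact Prod.ext hpr (by rw [← hρ p hp, ← hρ r hr, hpr])
    rw [← hc, ← card_perm_agreeing ρ (J.image Prod.fst)]
    refine Finset.card_le_card fun π => ?_
    simp only [Finset.mem_filter, Finset.mem_univ, true_and, Finset.mem_image,
      forall_exists_index, and_imp]
    rintro h1 i p hp rfl
    rw [h1 p hp, hρ p hp]

theorem sum_perm_apply (w : Fin n → Fin n → ℝ) (i : Fin n) :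
    ∑ π : Equiv.Perm (Fin n), w i (π i) = (n - 1)! * ∑ j, w i j := by
  rw [← Finset.sum_fiberwise_of_maps_to (s := Finset.univ) (t := Finset.univ)
    (g := fun π : Equiv.Perm (Fin n) => π i) (fun _ _ => Finset.mem_univ _), Finset.mul_sum]
  refine Finset.sum_congr rfl fun j _ => ?_
  have h := card_perm_agreeing (Equiv.swap i j) {i}
  simp only [Finset.mem_singleton, forall_eq, Equiv.swap_apply_left, Finset.card_singleton] at h
  rw [Finset.sum_congr rfl fun π hπ => by rw [(Finset.mem_filter.1 hπ).2], Finset.sum_const, h,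
    nsmul_eq_mul]

theorem sum_perm_sum (w : Fin n → Fin n → ℝ) :
    ∑ π : Equiv.Perm (Fin n), ∑ i, w i (π i) = (n - 1)! * ∑ i, ∑ j, w i j := by
  rw [Finset.sum_comm, Finset.mul_sum]
  exact Finset.sum_congr rfl fun i _ => sum_perm_apply w i

/-- Expand the right-hand product over all choices of one column per row of `I`; each choice is
realized by at most `(n - I.card)!` permutations, and by none if it is not injective. -/
theorem sum_perm_prod_le {w : Fin n → Fin n → ℝ} (hw : ∀ i j, 0 ≤ w i j) (I : Finset (Fin n)) :
    ∑ π : Equiv.Perm (Fin n), ∏ i ∈ I, w i (π i) ≤ (n - I.card)! * ∏ i ∈ I, ∑ j, w i j := by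
  rw [Finset.prod_sum, ← Finset.sum_fiberwise_of_maps_to (s := Finset.univ)
    (t := I.pi fun _ => Finset.univ) (g := fun (π : Equiv.Perm (Fin n)) i _ => π i) (by simp),
    Finset.mul_sum]
  refine Finset.sum_le_sum fun g _ => ?_
  have h : ∀ π ∈ Finset.univ.filter fun π : Equiv.Perm (Fin n) => (fun i (_ : i ∈ I) => π i) = g,
      ∏ i ∈ I, w i (π i) = ∏ x ∈ I.attach, w x.1 (g x.1 x.2) := by
    intro π hπ
    rw [← (Finset.mem_filter.1 hπ).2, Finset.prod_attach I fun i => w i (π i)]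
  rw [Finset.sum_congr rfl h, Finset.sum_const, nsmul_eq_mul]
  refine mul_le_mul_of_nonneg_right ?_ (Finset.prod_nonneg fun _ _ => hw _ _)
  rw [Nat.cast_le]
  refine le_trans (Finset.card_le_card fun π hπ => ?_)
    (card_perm_agreeing_le (fun i => if hi : i ∈ I then g i hi else i) I)
  simp only [Finset.mem_filter, Finset.mem_univ, true_and] at hπ ⊢
  intro i hi
  rw [dif_pos hi, ← hπ]

/-- The first term comes from the pairs `i = k`. For `i ≠ k` the coefficient is `(n - 2)!`, at most
`2 (n - 1)! / n` because `n ≤ 2 (n - 1)`. -/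
theorem sum_perm_sum_sq_le {w : Fin n → Fin n → ℝ} (hw : ∀ i j, 0 ≤ w i j) :
    ∑ π : Equiv.Perm (Fin n), (∑ i, w i (π i)) ^ 2 ≤
      (n - 1)! * (∑ i, ∑ j, w i j ^ 2) + 2 * ((n - 1)! / n) * (∑ i, ∑ j, w i j) ^ 2 := by
  have h1 : ∀ i k, ∑ π : Equiv.Perm (Fin n), w i (π i) * w k (π k) ≤
      (if i = k then (n - 1)! * ∑ j, w i j ^ 2 else 0) +
        2 * ((n - 1)! / n) * ((∑ j, w i j) * ∑ j, w k j) := by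
    intro i k
    have hnn : 0 ≤ (∑ j, w i j) * ∑ j, w k j :=
      mul_nonneg (Finset.sum_nonneg fun _ _ => hw _ _) (Finset.sum_nonneg fun _ _ => hw _ _)
    split_ifs with h
    · subst h
      simp only [← pow_two]
      rw [sum_perm_apply (fun i j => w i j ^ 2) i]
      have : 0 ≤ 2 * (((n - 1)! : ℝ) / n) * (∑ j, w i j) ^ 2 := by positivity
      linarith
    · have h2 := sum_perm_prod_le hw {i, k}
      simp only [Finset.prod_pair h, Finset.card_pair h] at h2
      rw [zero_add]
      refine h2.trans (mul_le_mul_of_nonneg_right ?_ hnn)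
      have hn : 2 ≤ n := by
        by_contra! hn
        exact h (by ext; omega)
      obtain ⟨m, rfl⟩ := Nat.exists_eq_add_of_le' hn
      rw [mul_div_assoc', le_div_iff₀ (by positivity)]
      have : m + 2 - 1 = m + 1 := by omega
      rw [this, Nat.add_sub_cancel, Nat.factorial_succ]
      push_cast
      have : (0 : ℝ) < m ! := by positivity
      nlinarith [mul_nonneg this.le (Nat.cast_nonneg (α := ℝ) m)]
  calc ∑ π : Equiv.Perm (Fin n), (∑ i, w i (π i)) ^ 2
      = ∑ i, ∑ k, ∑ π : Equiv.Perm (Fin n), w i (π i) * w k (π k) := by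
        simp_rw [pow_two, Finset.sum_mul_sum]
        rw [Finset.sum_comm]
        exact Finset.sum_congr rfl fun i _ => Finset.sum_comm
    _ ≤ ∑ i, ∑ k, ((if i = k then (n - 1)! * ∑ j, w i j ^ 2 else 0) +
        2 * ((n - 1)! / n) * ((∑ j, w i j) * ∑ j, w k j)) :=
        Finset.sum_le_sum fun i _ => Finset.sum_le_sum fun k _ => h1 i k
    _ = _ := by
        simp_rw [Finset.sum_add_distrib, Finset.sum_ite_eq, Finset.mem_univ, if_true,
          ← Finset.mul_sum, ← Finset.sum_mul, pow_two]

/-- For `S = ∑ w_{i,π(i)}` with mean `M`, the second moment bound gives `E (S - S² / (4 L)) ≥ M / 4`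
as soon as `K + 2 M ≤ 3 L`, where `K` bounds the entries of `w`. -/
theorem le_sum_perm_sub_sq (hn : 0 < n) {w : Fin n → Fin n → ℝ} {K M L : ℝ}
    (hw : ∀ i j, 0 ≤ w i j) (hK : ∀ i j, w i j ≤ K) (hM : ∑ i, ∑ j, w i j = n * M) (hL : 0 < L)
    (hKM : K + 2 * M ≤ 3 * L) :
    n ! * (M / 4) ≤
      ∑ π : Equiv.Perm (Fin n), (∑ i, w i (π i) - (∑ i, w i (π i)) ^ 2 / (4 * L)) := by
  have hn' : (0 : ℝ) < n := by positivity
  have hfac : (n ! : ℝ) = n * (n - 1)! := by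
    rw [← Nat.cast_mul, Nat.mul_factorial_pred hn.ne']
  have hM0 : 0 ≤ M := by
    have : 0 ≤ n * M := hM ▸ Finset.sum_nonneg fun i _ => Finset.sum_nonneg fun j _ => hw i j
    exact nonneg_of_mul_nonneg_right this hn'
  have h2 := sum_perm_sum_sq_le hw
  have h3 : ∑ i, ∑ j, w i j ^ 2 ≤ K * (n * M) := by
    rw [← hM, Finset.mul_sum]
    refine Finset.sum_le_sum fun i _ => ?_
    rw [Finset.mul_sum]
    refine Finset.sum_le_sum fun j _ => ?_
    rw [pow_two]
    exact mul_le_mul_of_nonneg_right (hK i j) (hw i j)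
  rw [Finset.sum_sub_distrib, sum_perm_sum, ← Finset.sum_div, hM]
  rw [hM] at h2
  have hf : (0 : ℝ) < (n - 1)! := by positivity
  have h4 : ∑ π : Equiv.Perm (Fin n), (∑ i, w i (π i)) ^ 2 ≤ n ! * M * (3 * L) := by
    calc _ ≤ _ := h2
      _ ≤ (n - 1)! * (K * (n * M)) + 2 * ((n - 1)! / n) * (n * M) ^ 2 := by gcongr
      _ = n ! * M * (K + 2 * M) := by rw [hfac]; field_simp
      _ ≤ _ := by gcongr
  have h5 : (∑ π : Equiv.Perm (Fin n), (∑ i, w i (π i)) ^ 2) / (4 * L) ≤ n ! * M * (3 / 4) := by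
    rw [div_le_iff₀ (by positivity)]
    calc _ ≤ _ := h4
      _ = _ := by ring
  calc n ! * (M / 4) = n ! * M - n ! * M * (3 / 4) := by ring
    _ ≤ _ := by rw [hfac] at h5 ⊢; linarith

/-- With `S` the number of hits, `S - S² / 4` is at most `1` and vanishes when `S = 0`, so its mean,
which is at least `A.card / (4n)`, bounds the probability of a hit from below. -/
theorem card_le_card_perm_hitting (hn : 0 < n) (A : Finset (Fin n × Fin n)) (hA : A.card ≤ n) :
    A.card * n ! ≤
      4 * ((Finset.univ.filter fun π : Equiv.Perm (Fin n) => ∃ i, (i, π i) ∈ A).card * n) := by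
  classical
  have hn' : (0 : ℝ) < n := by positivity
  have h := le_sum_perm_sub_sq hn (w := fun i j => if (i, j) ∈ A then (1 : ℝ) else 0) (K := 1)
    (M := A.card / n) (L := 1) (fun _ _ => by split_ifs <;> norm_num)
    (fun _ _ => by split_ifs <;> norm_num)
    (by
      rw [← Finset.sum_product' (f := fun i j => if (i, j) ∈ A then (1 : ℝ) else 0)]
      simp only [Finset.univ_product_univ, Prod.mk.eta, Finset.sum_ite_mem, Finset.univ_inter,
        Finset.sum_const, nsmul_eq_mul, mul_one]
      field_simp) one_pos
    (by
      have : (A.card : ℝ) / n ≤ 1 := by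
        rw [div_le_one hn']
        exact_mod_cast hA
      linarith)
  have h2 : ∑ π : Equiv.Perm (Fin n), ((∑ i, if (i, π i) ∈ A then (1 : ℝ) else 0) -
      (∑ i, if (i, π i) ∈ A then (1 : ℝ) else 0) ^ 2 / (4 * 1)) ≤
      ∑ π : Equiv.Perm (Fin n), if ∃ i, (i, π i) ∈ A then (1 : ℝ) else 0 := by
    refine Finset.sum_le_sum fun π _ => ?_
    split_ifs with hh
    · nlinarith [sq_nonneg ((∑ i, if (i, π i) ∈ A then (1 : ℝ) else 0) - 2)]
    · push Not at hh
      simp [hh]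
  rw [Finset.sum_boole] at h2
  have h3 := h.trans h2
  have h4 : (A.card : ℝ) * n ! ≤ 4 * ((Finset.univ.filter
      fun π : Equiv.Perm (Fin n) => ∃ i, (i, π i) ∈ A).card * n) := by
    calc (A.card : ℝ) * n ! = (n ! * (A.card / n / 4)) * (4 * n) := by field_simp
      _ ≤ _ := mul_le_mul_of_nonneg_right h3 (by positivity)
      _ = _ := by ring
  exact_mod_cast h4

/-- For `u ≥ 0` one has `u - u² / 4 ≤ u ^ (1 / q)`; take `u` to be the sum along `π` divided by its
mean `M` and average. -/
theorem le_sum_perm_rpow (hn : 0 < n) {w : Fin n → Fin n → ℝ} {K M q : ℝ}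
    (hw : ∀ i j, 0 ≤ w i j) (hK : ∀ i j, w i j ≤ K) (hM : ∑ i, ∑ j, w i j = n * M) (hKM : K ≤ M)
    (hq : 1 ≤ q) :
    n ! * (M ^ (1 / q) / 4) ≤ ∑ π : Equiv.Perm (Fin n), (∑ i, w i (π i)) ^ (1 / q) := by
  have hq0 : 0 < q := by linarith
  have hq1 : 1 / q ≤ 1 := by rw [div_le_one hq0]; exact hq
  have hq2 : 0 < 1 / q := by positivity
  have hM0 : 0 ≤ M := le_trans (le_trans (hw ⟨0, hn⟩ ⟨0, hn⟩) (hK _ _)) hKM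
  have hS : ∀ π : Equiv.Perm (Fin n), 0 ≤ ∑ i, w i (π i) :=
    fun π => Finset.sum_nonneg fun _ _ => hw _ _
  rcases hM0.eq_or_lt with h0 | h0
  · rw [← h0, Real.zero_rpow hq2.ne']
    simp only [zero_div, mul_zero]
    exact Finset.sum_nonneg fun π _ => Real.rpow_nonneg (hS π) _
  have h := le_sum_perm_sub_sq hn hw hK hM h0 (by linarith)
  have key : ∀ u : ℝ, 0 ≤ u → u - u ^ 2 / 4 ≤ u ^ (1 / q) := by
    intro u hu
    rcases le_total u 1 with h1 | h1
    · have : u ^ (1 : ℝ) ≤ u ^ (1 / q) := by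
        rcases hu.eq_or_lt with h2 | h2
        · rw [← h2, Real.zero_rpow one_ne_zero, Real.zero_rpow hq2.ne']
        · exact Real.rpow_le_rpow_of_exponent_ge h2 h1 hq1
      rw [Real.rpow_one] at this
      nlinarith [sq_nonneg u]
    · have : 1 ≤ u ^ (1 / q) := Real.one_le_rpow h1 hq2.le
      nlinarith [sq_nonneg (u - 2)]
  have hM1 : 0 < M ^ (1 / q) := Real.rpow_pos_of_pos h0 _
  calc n ! * (M ^ (1 / q) / 4) = M ^ (1 / q) / M * (n ! * (M / 4)) := by field_simp
    _ ≤ M ^ (1 / q) / M *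
        ∑ π : Equiv.Perm (Fin n), (∑ i, w i (π i) - (∑ i, w i (π i)) ^ 2 / (4 * M)) := by gcongr
    _ ≤ _ := by
      rw [Finset.mul_sum]
      refine Finset.sum_le_sum fun π _ => ?_
      have h1 := key ((∑ i, w i (π i)) / M) (div_nonneg (hS π) hM0)
      rw [Real.div_rpow (hS π) hM0, le_div_iff₀ hM1] at h1
      calc _ = _ := ?_
        _ ≤ _ := h1
      field_simp

/-- From the permutations fixing `J`, discard by a union bound those fixing another point of `S`.
The discarded proportion is at most `(S.card - J.card) / (n - J.card) ≤ 2 / 3`, with equality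
possible for `n = 3`. -/
theorem factorial_le_card_perm_exactly_fixing (hn : 2 ≤ n) {S J : Finset (Fin n)} (hJ : J ⊆ S)
    (hS : 2 * S.card ≤ n + 1) :
    (n - J.card)! ≤
      3 * (Finset.univ.filter fun π : Equiv.Perm (Fin n) => ∀ i ∈ S, (π i = i ↔ i ∈ J)).card := by
  set X := Finset.univ.filter fun π : Equiv.Perm (Fin n) => ∀ i ∈ S, (π i = i ↔ i ∈ J) with hX
  have hJS := Finset.card_le_card hJ
  have h1 : (Finset.univ.filter fun π : Equiv.Perm (Fin n) => ∀ i ∈ J, π i = i) ⊆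
      X ∪ (S \ J).biUnion fun a =>
        Finset.univ.filter fun π : Equiv.Perm (Fin n) => ∀ i ∈ insert a J, π i = i := by
    intro π hπ
    simp only [Finset.mem_filter, Finset.mem_univ, true_and] at hπ
    by_cases h : ∃ a ∈ S, a ∉ J ∧ π a = a
    · obtain ⟨a, ha, haJ, hpa⟩ := h
      refine Finset.mem_union_right _ (Finset.mem_biUnion.2 ⟨a, Finset.mem_sdiff.2 ⟨ha, haJ⟩, ?_⟩)
      simp only [Finset.mem_filter, Finset.mem_univ, true_and, Finset.mem_insert,
        forall_eq_or_imp]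
      exact ⟨hpa, hπ⟩
    · push Not at h
      refine Finset.mem_union_left _ ?_
      rw [hX]
      simp only [Finset.mem_filter, Finset.mem_univ, true_and]
      exact fun i hi => ⟨fun h2 => by_contra fun h3 => h i hi h3 h2, fun h2 => hπ i h2⟩
  have h2 := (Finset.card_le_card h1).trans (Finset.card_union_le _ _)
  have h3 : ((S \ J).biUnion fun a =>
      Finset.univ.filter fun π : Equiv.Perm (Fin n) => ∀ i ∈ insert a J, π i = i).card ≤
      (S \ J).card * (n - (J.card + 1))! := by
    refine Finset.card_biUnion_le_card_mul _ _ _ fun a ha => ?_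
    rw [card_perm_fixing, Finset.card_insert_of_notMem (Finset.mem_sdiff.1 ha).2]
  rw [card_perm_fixing] at h2
  rw [Finset.card_sdiff_of_subset hJ] at h3
  obtain ⟨r, hr⟩ : ∃ r, n - J.card = r + 1 := ⟨n - J.card - 1, by omega⟩
  have hr2 : n - (J.card + 1) = r := by omega
  rw [hr2] at h3
  rw [hr, Nat.factorial_succ] at h2 ⊢
  obtain ⟨d, hd⟩ : ∃ d, S.card - J.card = d := ⟨_, rfl⟩
  rw [hd] at h3
  have h5 : r + 1 ≤ 3 * (r + 1 - d) := by omega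
  have h6 : (r + 1) * r ! ≤ 3 * (r + 1 - d) * r ! := Nat.mul_le_mul_right _ h5
  obtain ⟨e, he⟩ : ∃ e, r + 1 = d + e := ⟨r + 1 - d, by omega⟩
  rw [he] at h2 h6 ⊢
  rw [Nat.add_sub_cancel_left] at h6
  nlinarith

end PermutationCounting

/-! ### Two-sided bounds for elementary symmetric sums -/

section ElementarySymmetric

variable {ι : Type*}

/-- The elementary symmetric sum of degree `k` of `w` over `s`. -/
def elemSymm (w : ι → ℝ) (s : Finset ι) (k : ℕ) : ℝ := ∑ I ∈ s.powersetCard k, ∏ i ∈ I, w i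

theorem elemSymm_zero (w : ι → ℝ) (s : Finset ι) : elemSymm w s 0 = 1 := by
  simp [elemSymm]

theorem elemSymm_empty_succ (w : ι → ℝ) (k : ℕ) : elemSymm w ∅ (k + 1) = 0 := by
  rw [elemSymm, Finset.powersetCard_eq_empty.2 (by simp), Finset.sum_empty]

theorem elemSymm_nonneg {w : ι → ℝ} (hw : ∀ i, 0 ≤ w i) (s : Finset ι) (k : ℕ) :
    0 ≤ elemSymm w s k :=
  Finset.sum_nonneg fun _ _ => Finset.prod_nonneg fun i _ => hw i

theorem elemSymm_insert [DecidableEq ι] (w : ι → ℝ) {s : Finset ι} {a : ι} (ha : a ∉ s) (k : ℕ) :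
    elemSymm w (insert a s) (k + 1) = elemSymm w s (k + 1) + w a * elemSymm w s k := by
  rw [elemSymm, Finset.powersetCard_succ_insert ha, Finset.sum_union, elemSymm, elemSymm,
    Finset.mul_sum, Finset.sum_image]
  · congr 1
    refine Finset.sum_congr rfl fun I hI => ?_
    rw [Finset.prod_insert fun h => ha ((Finset.mem_powersetCard.1 hI).1 h)]
  · intro I hI J hJ h
    have h1 : a ∉ I := fun h => ha ((Finset.mem_powersetCard.1 hI).1 h)
    have h2 : a ∉ J := fun h => ha ((Finset.mem_powersetCard.1 hJ).1 h)
    rw [← Finset.erase_insert h1, ← Finset.erase_insert h2]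
    exact congrArg (Finset.erase · a) h
  · rw [Finset.disjoint_left]
    intro I hI hI2
    obtain ⟨J, _, rfl⟩ := Finset.mem_image.1 hI2
    exact ha ((Finset.mem_powersetCard.1 hI).1 (Finset.mem_insert_self _ _))

/-- Multiplying out the right-hand side produces each product over `k + 1` distinct indices `k + 1`
times, plus nonnegative terms with a repeated index. -/
theorem succ_mul_elemSymm_le [DecidableEq ι] {w : ι → ℝ} (hw : ∀ i, 0 ≤ w i) (s : Finset ι) (k : ℕ) :
    (k + 1) * elemSymm w s (k + 1) ≤ (∑ i ∈ s, w i) * elemSymm w s k := by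
  induction s using Finset.induction_on generalizing k with
  | empty => simp [elemSymm_empty_succ]
  | insert a s ha ih =>
    rw [elemSymm_insert w ha, Finset.sum_insert ha]
    have h0 := ih k
    cases k with
    | zero =>
      simp only [elemSymm_zero] at h0 ⊢
      push_cast at h0 ⊢
      nlinarith
    | succ k =>
      have h1 := mul_le_mul_of_nonneg_left (ih k) (hw a)
      rw [elemSymm_insert w ha]
      push_cast at h0 h1 ⊢
      nlinarith [mul_nonneg (mul_nonneg (hw a) (hw a)) (elemSymm_nonneg hw s k)]

/-- The terms with a repeated index contribute at most `k * elemSymm w s k`, because `w i ^ 2 ≤ w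
i`. -/
theorem le_succ_mul_elemSymm [DecidableEq ι] {w : ι → ℝ} (hw : ∀ i, 0 ≤ w i)
    (hw1 : ∀ i, w i ≤ 1) (s : Finset ι) (k : ℕ) : (∑ i ∈ s, w i - k) * elemSymm w s k ≤ (k + 1) * elemSymm w s (k + 1) := by
  induction s using Finset.induction_on generalizing k with
  | empty =>
    rw [elemSymm_empty_succ, Finset.sum_empty, zero_sub, mul_zero]
    exact mul_nonpos_of_nonpos_of_nonneg (by simp) (elemSymm_nonneg hw _ _)
  | insert a s ha ih =>
    rw [elemSymm_insert w ha, Finset.sum_insert ha]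
    have h0 := ih k
    cases k with
    | zero =>
      simp only [elemSymm_zero] at h0 ⊢
      push_cast at h0 ⊢
      nlinarith
    | succ k =>
      have h1 := mul_le_mul_of_nonneg_left (ih k) (hw a)
      rw [elemSymm_insert w ha]
      push_cast at h0 h1 ⊢
      nlinarith [mul_nonneg (mul_nonneg (hw a) (sub_nonneg.2 (hw1 a))) (elemSymm_nonneg hw s k)]

theorem elemSymm_le_pow_div [DecidableEq ι] {w : ι → ℝ} (hw : ∀ i, 0 ≤ w i) (s : Finset ι) (k : ℕ) :
    elemSymm w s k ≤ (∑ i ∈ s, w i) ^ k / k ! := by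
  induction k with
  | zero => simp [elemSymm_zero]
  | succ k ih =>
    have h := succ_mul_elemSymm_le hw s k
    have hS : 0 ≤ ∑ i ∈ s, w i := Finset.sum_nonneg fun i _ => hw i
    rw [le_div_iff₀ (by positivity)] at ih ⊢
    rw [Nat.factorial_succ, pow_succ]
    push_cast
    have hf : (0 : ℝ) < k ! := by positivity
    calc elemSymm w s (k + 1) * ((k + 1) * k !) = ((k + 1) * elemSymm w s (k + 1)) * k ! := by ring
      _ ≤ ((∑ i ∈ s, w i) * elemSymm w s k) * k ! := by gcongr
      _ = (∑ i ∈ s, w i) * (elemSymm w s k * k !) := by ring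
      _ ≤ (∑ i ∈ s, w i) * (∑ i ∈ s, w i) ^ k := by gcongr
      _ = _ := by ring

theorem pow_div_le_elemSymm [DecidableEq ι] {w : ι → ℝ} (hw : ∀ i, 0 ≤ w i)
    (hw1 : ∀ i, w i ≤ 1) (s : Finset ι) {a : ℝ} (ha : 0 ≤ a) (k : ℕ) (h : a + k ≤ ∑ i ∈ s, w i) : a ^ k / k ! ≤ elemSymm w s k := by
  induction k with
  | zero => simp [elemSymm_zero]
  | succ k ih =>
    push_cast at h
    have h1 := le_succ_mul_elemSymm hw hw1 s k
    have ih := ih (by linarith)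
    rw [div_le_iff₀ (by positivity)] at ih ⊢
    rw [Nat.factorial_succ, pow_succ]
    push_cast
    have hf : (0 : ℝ) < k ! := by positivity
    have he := elemSymm_nonneg hw s k
    calc a ^ k * a ≤ (elemSymm w s k * k !) * a := by gcongr
      _ = (a * elemSymm w s k) * k ! := by ring
      _ ≤ ((∑ i ∈ s, w i - k) * elemSymm w s k) * k ! := by gcongr; linarith
      _ ≤ ((k + 1) * elemSymm w s (k + 1)) * k ! := by gcongr
      _ = _ := by ring

end ElementarySymmetric

/-! ### Domination by the fixed points of a random permutation -/

section PermutationTails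

variable {n : ℕ}

theorem sum_perm_elemSymm_le {w : Fin n → Fin n → ℝ} (hw : ∀ i j, 0 ≤ w i j) (k : ℕ) :
    ∑ π : Equiv.Perm (Fin n), elemSymm (fun i => w i (π i)) Finset.univ k ≤
      (n - k)! * ((∑ i, ∑ j, w i j) ^ k / k !) := by
  simp only [elemSymm]
  rw [Finset.sum_comm]
  calc _ ≤ ∑ I ∈ Finset.powersetCard k (Finset.univ : Finset (Fin n)),
        (n - k)! * ∏ i ∈ I, ∑ j, w i j := by
        refine Finset.sum_le_sum fun I hI => ?_
        have := sum_perm_prod_le hw I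
        rwa [(Finset.mem_powersetCard.1 hI).2] at this
    _ = (n - k)! * elemSymm (fun i => ∑ j, w i j) Finset.univ k := by
        rw [← Finset.mul_sum, elemSymm]
    _ ≤ _ := by
        gcongr
        exact elemSymm_le_pow_div (fun i => Finset.sum_nonneg fun j _ => hw i j) _ _

/-- For different `k`-subsets `J` of `S`, the events that the fixed points in `S` are exactly `J`
are disjoint, and each has at least `(n - k)! / 3` elements. -/
theorem choose_mul_factorial_le_card_fixed (hn : 2 ≤ n) {S : Finset (Fin n)}
    (hS : 2 * S.card ≤ n + 1) (k : ℕ) :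
    S.card.choose k * (n - k)! ≤ 3 * (Finset.univ.filter fun π : Equiv.Perm (Fin n) =>
      k ≤ (S.filter fun i => π i = i).card).card := by
  calc S.card.choose k * (n - k)! = ∑ J ∈ S.powersetCard k, (n - J.card)! := by
        rw [Finset.sum_congr rfl fun J hJ => by rw [(Finset.mem_powersetCard.1 hJ).2],
          Finset.sum_const, Finset.card_powersetCard, smul_eq_mul]
    _ ≤ ∑ J ∈ S.powersetCard k, 3 * (Finset.univ.filter fun π : Equiv.Perm (Fin n) =>
          ∀ i ∈ S, (π i = i ↔ i ∈ J)).card := Finset.sum_le_sum fun J hJ =>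
        factorial_le_card_perm_exactly_fixing hn (Finset.mem_powersetCard.1 hJ).1 hS
    _ = 3 * ((S.powersetCard k).biUnion fun J => Finset.univ.filter
          fun π : Equiv.Perm (Fin n) => ∀ i ∈ S, (π i = i ↔ i ∈ J)).card := by
        rw [Finset.card_biUnion, Finset.mul_sum]
        intro I hI J hJ hIJ
        rw [Function.onFun, Finset.disjoint_left]
        intro π h1 h2
        simp only [Finset.mem_filter, Finset.mem_univ, true_and] at h1 h2
        refine hIJ (Finset.ext fun i => ⟨fun hi => ?_, fun hi => ?_⟩)
        · have := (Finset.mem_powersetCard.1 hI).1 hi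
          exact (h2 i this).1 ((h1 i this).2 hi)
        · have := (Finset.mem_powersetCard.1 hJ).1 hi
          exact (h1 i this).1 ((h2 i this).2 hi)
    _ ≤ _ := by
        gcongr
        intro π hπ
        simp only [Finset.mem_biUnion, Finset.mem_filter, Finset.mem_univ, true_and] at hπ ⊢
        obtain ⟨J, hJ, h⟩ := hπ
        rw [← (Finset.mem_powersetCard.1 hJ).2]
        refine Finset.card_le_card fun i hi => ?_
        have := (Finset.mem_powersetCard.1 hJ).1 hi
        exact Finset.mem_filter.2 ⟨this, (h i this).2 hi⟩

/-- Markov's inequality for the `k`-th elementary symmetric sum of the entries along `π`: it is at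
least `(4k)^k / k!` when the sum reaches `5k`, since `5k = 4k + k`, while its total over all
permutations is at most `(n - k)! n^k / k!`. -/
theorem card_perm_sum_ge_le (hn : 2 ≤ n) {w : Fin n → Fin n → ℝ} (hw : ∀ i j, 0 ≤ w i j)
    (hw1 : ∀ i j, w i j ≤ 1) (hsum : ∑ i, ∑ j, w i j ≤ n) {S : Finset (Fin n)}
    (hS : 2 * S.card ≤ n + 1) (hS' : n ≤ 2 * S.card) (k : ℕ) :
    (Finset.univ.filter fun π : Equiv.Perm (Fin n) => 5 * (k : ℝ) ≤ ∑ i, w i (π i)).card ≤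
      3 * (Finset.univ.filter fun π : Equiv.Perm (Fin n) =>
        k ≤ (S.filter fun i => π i = i).card).card := by
  refine le_trans ?_ (choose_mul_factorial_le_card_fixed hn hS k)
  rcases Nat.eq_zero_or_pos k with rfl | hk
  · simp only [Nat.choose_zero_right, one_mul, Nat.sub_zero]
    refine (Finset.card_filter_le _ _).trans ?_
    rw [Finset.card_univ, Fintype.card_perm, Fintype.card_fin]
  set X := Finset.univ.filter fun π : Equiv.Perm (Fin n) => 5 * (k : ℝ) ≤ ∑ i, w i (π i) with hX
  rcases X.eq_empty_or_nonempty with h | ⟨ρ, hρ⟩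
  · simp [h]
  -- The sum along any permutation is at most `n`, so a nonempty `X` forces `k ≤ n / 5`.
  have hkn : 5 * k ≤ n := by
    have h1 : ∑ i, w i (ρ i) ≤ n := by
      calc ∑ i, w i (ρ i) ≤ ∑ _i : Fin n, (1 : ℝ) := Finset.sum_le_sum fun i _ => hw1 _ _
        _ = n := by simp
    have h2 := (Finset.mem_filter.1 hρ).2.trans h1
    exact_mod_cast h2
  have hk0 : (0 : ℝ) < k := by exact_mod_cast hk
  have h1 : (X.card : ℝ) * ((4 * k) ^ k / k !) ≤ (n - k)! * ((n : ℝ) ^ k / k !) := by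
    calc (X.card : ℝ) * ((4 * k) ^ k / k !)
        = ∑ _π ∈ X, ((4 * (k : ℝ)) ^ k / k !) := by rw [Finset.sum_const, nsmul_eq_mul]
      _ ≤ ∑ π ∈ X, elemSymm (fun i => w i (π i)) Finset.univ k := by
          refine Finset.sum_le_sum fun π hπ => ?_
          refine pow_div_le_elemSymm (fun i => hw _ _) (fun i => hw1 _ _) _ (by positivity) _ ?_
          linarith [(Finset.mem_filter.1 hπ).2]
      _ ≤ ∑ π : Equiv.Perm (Fin n), elemSymm (fun i => w i (π i)) Finset.univ k :=
          Finset.sum_le_univ_sum_of_nonneg fun π => elemSymm_nonneg (fun i => hw _ _) _ _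
      _ ≤ _ := sum_perm_elemSymm_le hw k
      _ ≤ _ := by
          gcongr
          exact Finset.sum_nonneg fun i _ => Finset.sum_nonneg fun j _ => hw i j
  have h2 : (n : ℝ) ^ k ≤ (4 * k) ^ k * S.card.choose k := by
    have h3 := Nat.pow_le_choose (α := ℝ) k S.card
    have h4 : (k ! : ℝ) ≤ (k : ℝ) ^ k := by exact_mod_cast Nat.factorial_le_pow k
    rw [div_le_iff₀ (by positivity)] at h3
    -- Here `S.card ≥ n / 2` and `k ≤ n / 5`, which leaves at least `n / 4`.
    have h5 : (n : ℝ) ≤ 4 * ((S.card + 1 - k : ℕ) : ℝ) := by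
      have : n ≤ 4 * (S.card + 1 - k) := by omega
      exact_mod_cast this
    calc (n : ℝ) ^ k ≤ (4 * ((S.card + 1 - k : ℕ) : ℝ)) ^ k := by gcongr
      _ = 4 ^ k * ((S.card + 1 - k : ℕ) : ℝ) ^ k := mul_pow _ _ _
      _ ≤ 4 ^ k * (S.card.choose k * k !) := by gcongr
      _ ≤ 4 ^ k * (S.card.choose k * k ^ k) := by gcongr
      _ = _ := by rw [mul_pow]; ring
  have hf : (0 : ℝ) < k ! := by positivity
  rw [mul_div_assoc', mul_div_assoc', div_le_div_iff_of_pos_right hf] at h1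
  have h6 : (X.card : ℝ) * (4 * k) ^ k ≤ (S.card.choose k * (n - k)!) * (4 * k) ^ k := by
    calc _ ≤ _ := h1
      _ ≤ ((n - k)! : ℝ) * ((4 * k) ^ k * S.card.choose k) := by gcongr
      _ = _ := by ring
  have h7 := le_of_mul_le_mul_right h6 (by positivity)
  exact_mod_cast h7

/-- Condition on the exact set `J ⊆ A` of positions that contribute. On the left it occurs for at
most `(n - J.card)!` permutations, on the right for at least a third of that number, and the sum
over `J` is the same on both sides. -/
theorem card_perm_hit_sum_le (hn : 2 ≤ n) {A : Finset (Fin n × Fin n)} (hA : 2 * A.card ≤ n + 1)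
    {e : Fin n × Fin n → Fin n} (he : Set.InjOn e A) (v : Fin n × Fin n → ℝ) (s : ℝ) :
    (Finset.univ.filter fun π : Equiv.Perm (Fin n) =>
      s < ∑ p ∈ A with π p.1 = p.2, v p).card ≤
    3 * (Finset.univ.filter fun π : Equiv.Perm (Fin n) =>
      s < ∑ p ∈ A with π (e p) = e p, v p).card := by
  have h1 : ∀ F : Equiv.Perm (Fin n) → Finset (Fin n × Fin n), (∀ π, F π ⊆ A) →
      (Finset.univ.filter fun π => s < ∑ p ∈ F π, v p).card =
        ∑ J ∈ A.powerset with s < ∑ p ∈ J, v p, (Finset.univ.filter fun π => F π = J).card := by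
    intro F hF
    rw [Finset.card_eq_sum_card_fiberwise (f := F)
      (t := A.powerset.filter fun J => s < ∑ p ∈ J, v p)]
    · refine Finset.sum_congr rfl fun J hJ => ?_
      congr 1
      ext π
      simp only [Finset.mem_filter, Finset.mem_univ, true_and, and_iff_right_iff_imp]
      rintro rfl
      exact (Finset.mem_filter.1 hJ).2
    · intro π hπ
      simpa [hF π] using hπ
  rw [h1 _ fun π => Finset.filter_subset _ _, h1 _ fun π => Finset.filter_subset _ _,
    Finset.mul_sum]
  refine Finset.sum_le_sum fun J hJ => ?_
  have hJA : J ⊆ A := Finset.mem_powerset.1 (Finset.mem_filter.1 hJ).1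
  have h2 := factorial_le_card_perm_exactly_fixing hn (Finset.image_subset_image (f := e) hJA)
    (by rwa [Finset.card_image_of_injOn he])
  rw [Finset.card_image_of_injOn (he.mono (by exact_mod_cast hJA))] at h2
  refine le_trans (Finset.card_le_card fun π hπ => ?_) ((card_perm_hitting_le J).trans
    (h2.trans (Nat.mul_le_mul_left 3 (Finset.card_le_card fun π hπ => ?_))))
  · simp only [Finset.mem_filter, Finset.mem_univ, true_and] at hπ ⊢
    intro p hp
    rw [← hπ] at hp
    exact (Finset.mem_filter.1 hp).2
  · simp only [Finset.mem_filter, Finset.mem_univ, true_and] at hπ ⊢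
    ext p
    rw [Finset.mem_filter]
    constructor
    · rintro ⟨hp, h⟩
      obtain ⟨r, hr, hrp⟩ := Finset.mem_image.1 ((hπ _ (Finset.mem_image_of_mem e hp)).1 h)
      rwa [← he (hJA hr) hp hrp]
    · intro hp
      exact ⟨hJA hp, (hπ _ (Finset.mem_image_of_mem e (hJA hp))).2 (Finset.mem_image_of_mem e hp)⟩

end PermutationTails

/-! ### `T_q` and `U` as step functions; the ordered entries -/

section Representation

variable {n : ℕ}

/-- The step function on `[0,1]` with value `X π` on the interval of `π`. -/
noncomputable def permFun (ℓ : Equiv.Perm (Fin n) ≃ Fin n !) (X : Equiv.Perm (Fin n) → ℝ) :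
    UnitFun :=
  stepFun n ! fun k => if h : k < n ! then X (ℓ.symm ⟨k, h⟩) else 0

/-- The `ℓ_q` norm of the entries of `x` along the graph of `π`. -/
noncomputable def diagNorm (q : ℝ) (x : Matrix (Fin n) (Fin n) ℝ) (π : Equiv.Perm (Fin n)) : ℝ :=
  (∑ i, |x i (π i)| ^ q) ^ (1 / q)

theorem diagNorm_nonneg (q : ℝ) (x : Matrix (Fin n) (Fin n) ℝ) (π : Equiv.Perm (Fin n)) :
    0 ≤ diagNorm q x π :=
  Real.rpow_nonneg (Finset.sum_nonneg fun _ _ => Real.rpow_nonneg (abs_nonneg _) _) _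

theorem floor_mul_eq_iff {N : ℕ} (hN : 0 < N) {t : ℝ} (ht : 0 ≤ t) (k : ℕ) :
    ⌊(N : ℝ) * t⌋₊ = k ↔ t ∈ Set.Ico ((k : ℝ) / N) (((k : ℝ) + 1) / N) := by
  have hN' : (0 : ℝ) < N := by positivity
  rw [Nat.floor_eq_iff (by positivity), Set.mem_Ico, div_le_iff₀ hN', lt_div_iff₀ hN', mul_comm t]

theorem opT_eq_permFun (ℓ : Equiv.Perm (Fin n) ≃ Fin n !) (q : ℝ) (x : Matrix (Fin n) (Fin n) ℝ) :
    opT ℓ q x = permFun ℓ (diagNorm q x) := by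
  refine AEEqFun.mk_eq_mk.2 (ae_unitMeasure_of_Ico fun t ht => ?_)
  have hN : 0 < n ! := n.factorial_pos
  have hN' : (0 : ℝ) < (n ! : ℝ) := by positivity
  have hlt : ⌊(n ! : ℝ) * t⌋₊ < n ! := by
    rw [Nat.floor_lt (mul_nonneg hN'.le ht.1)]
    nlinarith [ht.2]
  simp only [opTFun]
  rw [dif_pos hlt, Finset.sum_eq_single (ℓ.symm ⟨_, hlt⟩)]
  · rw [Set.indicator_of_mem, diagNorm]
    rw [← floor_mul_eq_iff hN ht.1, Equiv.apply_symm_apply]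
  · intro π _ hπ
    rw [Set.indicator_of_notMem]
    rw [← floor_mul_eq_iff hN ht.1]
    intro h
    refine hπ ?_
    rw [Equiv.eq_symm_apply]
    exact Fin.ext h.symm
  · simp

theorem opU_eq_stepFun (hn : 0 < n) (x : Matrix (Fin n) (Fin n) ℝ) :
    opU x = stepFun n fun k => entryRearr x (k + 1) := by
  have hn' : (0 : ℝ) < n := by positivity
  have hfin : ∀ᵐ t ∂unitMeasure, t ∉ Set.range fun k : ℕ => (k : ℝ) / n :=
    measure_eq_zero_iff_ae_notMem.1 ((Set.countable_range _).measure_zero _)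
  refine AEEqFun.mk_eq_mk.2 ?_
  filter_upwards [hfin, ae_unitMeasure_of_Ico (p := fun t => t ∈ Set.Ico (0 : ℝ) 1) fun t ht => ht]
    with t h1 ht
  have hlt : ⌊(n : ℝ) * t⌋₊ < n := by
    rw [Nat.floor_lt (mul_nonneg hn'.le ht.1)]
    nlinarith [ht.2]
  have hmem := (floor_mul_eq_iff hn ht.1 ⌊(n : ℝ) * t⌋₊).1 rfl
  simp only [opUFun]
  rw [Finset.sum_eq_single (⌊(n : ℝ) * t⌋₊ + 1)]
  · rw [Set.indicator_of_mem]
    push_cast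
    rw [add_sub_cancel_right]
    exact ⟨lt_of_le_of_ne hmem.1 fun h => h1 ⟨_, h⟩, hmem.2⟩
  · intro k hk hne
    rw [Set.indicator_of_notMem]
    rintro ⟨h2, h3⟩
    obtain ⟨m, rfl⟩ : ∃ m, k = m + 1 := ⟨k - 1, by have := (Finset.mem_Icc.1 hk).1; omega⟩
    push_cast at h2 h3
    rw [add_sub_cancel_right] at h2
    exact hne (by rw [(floor_mul_eq_iff hn ht.1 m).2 ⟨h2.le, h3⟩])
  · intro h
    exact absurd (Finset.mem_Icc.2 ⟨by omega, by omega⟩) h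

theorem permFun_add (ℓ : Equiv.Perm (Fin n) ≃ Fin n !) (X Y : Equiv.Perm (Fin n) → ℝ) :
    permFun ℓ (X + Y) = permFun ℓ X + permFun ℓ Y := by
  rw [permFun, permFun, permFun, ← stepFun_add]
  congr 1
  ext k
  simp only [Pi.add_apply]
  split_ifs <;> simp

theorem permFun_smul (ℓ : Equiv.Perm (Fin n) ≃ Fin n !) (c : ℝ) (X : Equiv.Perm (Fin n) → ℝ) :
    permFun ℓ (c • X) = c • permFun ℓ X := by
  rw [permFun, permFun, ← stepFun_smul]
  congr 1
  ext k
  simp only [Pi.smul_apply]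
  split_ifs <;> simp

theorem card_filter_permFun (ℓ : Equiv.Perm (Fin n) ≃ Fin n !) (X : Equiv.Perm (Fin n) → ℝ)
    (s : ℝ) :
    ((Finset.range n !).filter fun k =>
      s < |if h : k < n ! then X (ℓ.symm ⟨k, h⟩) else 0|).card =
      (Finset.univ.filter fun π => s < |X π|).card := by
  refine (Finset.card_bij (fun π _ => (ℓ π : ℕ)) ?_ ?_ ?_).symm
  · intro π hπ
    simpa using hπ
  · intro π _ ρ _ h
    exact ℓ.injective (Fin.ext h)
  · intro k hk
    simp only [Finset.mem_filter, Finset.mem_range] at hk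
    obtain ⟨h1, h2⟩ := hk
    rw [dif_pos h1] at h2
    exact ⟨ℓ.symm ⟨k, h1⟩, by simpa using h2, by simp⟩

theorem sum_range_permFun (ℓ : Equiv.Perm (Fin n) ≃ Fin n !) (X : Equiv.Perm (Fin n) → ℝ) :
    ∑ k ∈ Finset.range n !, (if h : k < n ! then X (ℓ.symm ⟨k, h⟩) else 0) = ∑ π, X π := by
  rw [Finset.sum_range, ← ℓ.sum_comp]
  exact Finset.sum_congr rfl fun π _ => by simp

/-- Fixes a ranking of the positions, ties included, so that blocks of the rearrangement become sets
of positions. Ranks start at `0`, whereas `entryRearr` is indexed from `1`. -/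
theorem exists_entryRearr_equiv (x : Matrix (Fin n) (Fin n) ℝ) :
    ∃ σ : Fin (n ^ 2) ≃ Fin n × Fin n,
      Antitone (fun k => |x (σ k).1 (σ k).2|) ∧
        ∀ k : Fin (n ^ 2), entryRearr x (k + 1) = |x (σ k).1 (σ k).2| := by
  have e : Fin (n ^ 2) ≃ Fin n × Fin n :=
    (Fintype.equivFinOfCardEq (by simp [pow_two])).symm
  set g : Fin (n ^ 2) → ℝ := fun k => -|x (e k).1 (e k).2| with hg
  have hmono := Tuple.monotone_sort g
  refine ⟨(Tuple.sort g).trans e, fun a b hab => ?_, fun k => ?_⟩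
  · have := hmono hab
    simpa [hg] using this
  · set σ := (Tuple.sort g).trans e with hσ
    have hanti : Antitone fun k => |x (σ k).1 (σ k).2| := by
      intro a b hab
      have := hmono hab
      simpa [hg, hσ] using this
    have hl : ((Finset.univ : Finset (Fin n × Fin n)).val.map fun p => |x p.1 p.2|).sort (· ≥ ·) =
        List.ofFn fun k => |x (σ k).1 (σ k).2| := by
      refine List.Perm.eq_of_pairwise' (r := (· ≥ ·)) (Multiset.pairwise_sort _ _) ?_ ?_
      · rw [List.pairwise_ofFn]
        exact fun i j hij => hanti hij.le
      · rw [← Multiset.coe_eq_coe, Multiset.sort_eq, ← Fin.univ_val_map,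
          ← Finset.map_univ_equiv σ, Finset.map_val, Multiset.map_map]
        rfl
    rw [entryRearr, hl, Nat.add_sub_cancel, List.getD_eq_getElem _ _ (by simp)]
    simp

theorem lt_card_iff_lt_entryRearr (x : Matrix (Fin n) (Fin n) ℝ) (s : ℝ) {k : ℕ} (hk : k < n ^ 2) :
    k < (Finset.univ.filter fun p : Fin n × Fin n => s < |x p.1 p.2|).card ↔
      s < entryRearr x (k + 1) := by
  obtain ⟨σ, hanti, hσ⟩ := exists_entryRearr_equiv x
  have h := Tuple.lt_card_gt_iff_apply_gt_of_antitone (a := s) (j := ⟨k, hk⟩) hanti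
  rw [hσ ⟨k, hk⟩, ← h, Finset.card_equiv σ (t := Finset.univ.filter
    fun p : Fin n × Fin n => s < |x p.1 p.2|) (by simp)]

theorem card_filter_entryRearr (x : Matrix (Fin n) (Fin n) ℝ) (s : ℝ) :
    ((Finset.range n).filter fun k => s < entryRearr x (k + 1)).card =
      min n (Finset.univ.filter fun p : Fin n × Fin n => s < |x p.1 p.2|).card := by
  rw [← Finset.card_range (min n _)]
  congr 1
  ext k
  simp only [Finset.mem_filter, Finset.mem_range, lt_min_iff]
  refine and_congr_right fun hk => ?_
  rw [lt_card_iff_lt_entryRearr x s (by nlinarith)]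

theorem entryRearr_nonneg (x : Matrix (Fin n) (Fin n) ℝ) (k : ℕ) : 0 ≤ entryRearr x k := by
  rw [entryRearr, List.getD_eq_getElem?_getD]
  cases h : (((Finset.univ : Finset (Fin n × Fin n)).val.map fun p => |x p.1 p.2|).sort
      (· ≥ ·))[k - 1]? with
  | none => simp
  | some a =>
    have := List.mem_of_getElem? h
    rw [Multiset.mem_sort, Multiset.mem_map] at this
    obtain ⟨p, _, rfl⟩ := this
    exact abs_nonneg _

theorem sum_tail_eq {x : Matrix (Fin n) (Fin n) ℝ} {σ : Fin (n ^ 2) ≃ Fin n × Fin n}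
    (hσ : ∀ k : Fin (n ^ 2), entryRearr x (k + 1) = |x (σ k).1 (σ k).2|) (q : ℝ) :
    ∑ k ∈ Finset.Icc (n + 1) (n ^ 2), entryRearr x k ^ q =
      ∑ p : Fin n × Fin n, if n ≤ (σ.symm p : ℕ) then |x p.1 p.2| ^ q else 0 := by
  rw [← σ.sum_comp, ← Finset.sum_filter]
  refine (Finset.sum_bij (fun (k : Fin (n ^ 2)) _ => (k : ℕ) + 1) ?_ ?_ ?_ ?_).symm
  · intro k hk
    simp only [Finset.mem_filter, Finset.mem_univ, true_and, Equiv.symm_apply_apply] at hk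
    exact Finset.mem_Icc.2 ⟨by omega, by omega⟩
  · intro a _ b _ h
    exact Fin.ext (by omega)
  · intro k hk
    rw [Finset.mem_Icc] at hk
    exact ⟨⟨k - 1, by omega⟩, by simp; omega, by simp; omega⟩
  · intro k _
    rw [hσ k]

end Representation

/-! ### The lower estimate, valid in every r.i. space -/

namespace RISpace

variable (E : RISpace) {n : ℕ}

theorem nrm_stepFun_mono {N : ℕ} (hN : 0 < N) {w z : ℕ → ℝ} (h : ∀ k < N, |w k| ≤ |z k|) :
    E.nrm (stepFun N w) ≤ E.nrm (stepFun N z) := by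
  refine E.nrm_stepFun_le_of_card_le hN hN fun s _ => Nat.mul_le_mul_right _ ?_
  refine Finset.card_le_card fun k hk => ?_
  rw [Finset.mem_filter] at hk ⊢
  exact ⟨hk.1, hk.2.trans_le (h k (Finset.mem_range.1 hk.1))⟩

theorem nrm_permFun_le_mul (ℓ : Equiv.Perm (Fin n) ≃ Fin n !) {X Y : Equiv.Perm (Fin n) → ℝ}
    {c : ℕ} (hc : 0 < c) (h : ∀ s : ℝ, 0 ≤ s → (Finset.univ.filter fun π => s < |X π|).card ≤
      c * (Finset.univ.filter fun π => s < |Y π|).card) :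
    E.nrm (permFun ℓ X) ≤ c * E.nrm (permFun ℓ Y) := by
  refine E.nrm_stepFun_le_mul n.factorial_pos n.factorial_pos hc fun s hs => ?_
  rw [card_filter_permFun ℓ X s, card_filter_permFun ℓ Y s, ← mul_assoc]
  exact Nat.mul_le_mul_right _ (h s hs)

theorem nrm_permFun_mono (ℓ : Equiv.Perm (Fin n) ≃ Fin n !) {X Y : Equiv.Perm (Fin n) → ℝ}
    (h : ∀ π, |X π| ≤ |Y π|) : E.nrm (permFun ℓ X) ≤ E.nrm (permFun ℓ Y) := by
  refine E.nrm_stepFun_mono n.factorial_pos fun k hk => ?_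
  simpa [hk] using h _

theorem nrm_permFun_one_le (ℓ : Equiv.Perm (Fin n) ≃ Fin n !) : E.nrm (permFun ℓ 1) ≤ E.nrm 1 := by
  rw [← stepFun_one n !]
  exact E.nrm_stepFun_mono n.factorial_pos fun k hk => by simp [hk]

theorem nrm_opU_le_of_card_le (hn : 0 < n) {x y : Matrix (Fin n) (Fin n) ℝ}
    (h : ∀ s : ℝ, 0 ≤ s → (Finset.univ.filter fun p : Fin n × Fin n => s < |x p.1 p.2|).card ≤
      (Finset.univ.filter fun p : Fin n × Fin n => s < |y p.1 p.2|).card) :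
    E.nrm (opU x) ≤ E.nrm (opU y) := by
  rw [opU_eq_stepFun hn, opU_eq_stepFun hn]
  refine E.nrm_stepFun_le_of_card_le hn hn fun s hs => Nat.mul_le_mul_right _ ?_
  simp only [abs_of_nonneg (entryRearr_nonneg _ _), card_filter_entryRearr]
  exact min_le_min_left _ (h s hs)

theorem nrm_opT_add_le (ℓ : Equiv.Perm (Fin n) ≃ Fin n !) {q : ℝ} (hq : 1 ≤ q)
    (x y : Matrix (Fin n) (Fin n) ℝ) :
    E.nrm (opT ℓ q (x + y)) ≤ E.nrm (opT ℓ q x) + E.nrm (opT ℓ q y) := by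
  rw [opT_eq_permFun, opT_eq_permFun, opT_eq_permFun]
  refine le_trans ?_ (E.nrm_add_le _ _)
  rw [← permFun_add]
  refine E.nrm_permFun_mono ℓ fun π => ?_
  rw [Pi.add_apply, abs_of_nonneg (diagNorm_nonneg _ _ _),
    abs_of_nonneg (add_nonneg (diagNorm_nonneg _ _ _) (diagNorm_nonneg _ _ _))]
  exact Real.Lp_add_le _ _ _ hq

theorem nrm_opT_smul (ℓ : Equiv.Perm (Fin n) ≃ Fin n !) {q : ℝ} (hq : 1 ≤ q) (c : ℝ)
    (x : Matrix (Fin n) (Fin n) ℝ) : E.nrm (opT ℓ q (c • x)) = ‖c‖ₑ * E.nrm (opT ℓ q x) := by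
  have h : diagNorm q (c • x) = |c| • diagNorm q x := by
    ext π
    simp only [diagNorm, Matrix.smul_apply, Pi.smul_apply, smul_eq_mul, abs_mul]
    simp_rw [Real.mul_rpow (abs_nonneg c) (abs_nonneg _)]
    rw [← Finset.mul_sum, Real.mul_rpow (Real.rpow_nonneg (abs_nonneg c) _)
      (Finset.sum_nonneg fun _ _ => Real.rpow_nonneg (abs_nonneg _) _), ← Real.rpow_mul
      (abs_nonneg c), mul_one_div_cancel (by linarith), Real.rpow_one]
  rw [opT_eq_permFun, opT_eq_permFun, h, permFun_smul, E.nrm_smul, Real.enorm_abs]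

/-- At level `s`, choose `min n m` of the `m` positions whose entries exceed `s`. Hitting any one of
them already makes the `ℓ_q` norm along `π` exceed `s`. -/
theorem nrm_opU_le_nrm_opT (hn : 0 < n) (ℓ : Equiv.Perm (Fin n) ≃ Fin n !) {q : ℝ} (hq : 1 ≤ q)
    (x : Matrix (Fin n) (Fin n) ℝ) : E.nrm (opU x) ≤ 4 * E.nrm (opT ℓ q x) := by
  rw [opU_eq_stepFun hn, opT_eq_permFun]
  refine E.nrm_stepFun_le_mul (c := 4) hn n.factorial_pos (by norm_num) fun s hs => ?_
  rw [card_filter_permFun ℓ _ s]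
  simp only [abs_of_nonneg (entryRearr_nonneg _ _), card_filter_entryRearr]
  obtain ⟨A, hA, hAc⟩ := Finset.exists_subset_card_eq (min_le_right n
    (Finset.univ.filter fun p : Fin n × Fin n => s < |x p.1 p.2|).card)
  rw [← hAc]
  refine (card_le_card_perm_hitting hn A (by omega)).trans ?_
  gcongr 4 * (?_ * n)
  refine Finset.card_le_card fun π hπ => ?_
  simp only [Finset.mem_filter, Finset.mem_univ, true_and] at hπ ⊢
  obtain ⟨i, hi⟩ := hπ
  have h1 := hA hi
  simp only [Finset.mem_filter, Finset.mem_univ, true_and] at h1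
  rw [abs_of_nonneg (diagNorm_nonneg _ _ _)]
  refine h1.trans_le ?_
  have hq0 : q ≠ 0 := by linarith
  calc |x i (π i)| = (|x i (π i)| ^ q) ^ (1 / q) := by
        rw [← Real.rpow_mul (abs_nonneg _), mul_one_div_cancel hq0, Real.rpow_one]
    _ ≤ _ := by
        refine Real.rpow_le_rpow (Real.rpow_nonneg (abs_nonneg _) _) ?_ (by positivity)
        exact Finset.single_le_sum (f := fun i => |x i (π i)| ^ q)
          (fun _ _ => Real.rpow_nonneg (abs_nonneg _) _) (Finset.mem_univ i)

/-- The norm dominates the mean. Truncating the entries at `x_n^*` only lowers the mean, and makes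
each `q`-th power at most the average sum along `π`, as the second moment bound requires. -/
theorem ofReal_tailTerm_mul_le (hn : 0 < n) (ℓ : Equiv.Perm (Fin n) ≃ Fin n !) {q : ℝ}
    (hq : 1 ≤ q) (x : Matrix (Fin n) (Fin n) ℝ) :
    ENNReal.ofReal (tailTerm q x) * E.nrm 1 ≤ 4 * E.nrm (opT ℓ q x) := by
  obtain ⟨σ, hanti, hσ⟩ := exists_entryRearr_equiv x
  have hq0 : 0 < q := by linarith
  have hn' : (0 : ℝ) < n := by positivity
  have hlt : n - 1 < n ^ 2 := by
    have : n ≤ n ^ 2 := by nlinarith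
    omega
  -- This is `x_n^*`, whose zero-based rank is `n - 1`.
  set a : ℝ := |x (σ ⟨n - 1, hlt⟩).1 (σ ⟨n - 1, hlt⟩).2| with ha
  have ha0 : 0 ≤ a := abs_nonneg _
  set B : ℝ := (1 / (n : ℝ)) * ∑ k ∈ Finset.Icc (n + 1) (n ^ 2), entryRearr x k ^ q with hB
  have hB0 : 0 ≤ B := mul_nonneg (by positivity)
    (Finset.sum_nonneg fun k _ => Real.rpow_nonneg (entryRearr_nonneg x k) _)
  have haq : 0 ≤ a ^ q := Real.rpow_nonneg ha0 _
  -- The `n` top-ranked entries are cut down to `a`, and the later ones are unchanged.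
  have hsum : ∑ i, ∑ j, (min |x i j| a) ^ q = n * (a ^ q + B) := by
    rw [← Finset.sum_product' (f := fun i j => (min |x i j| a) ^ q), Finset.univ_product_univ,
      mul_add, hB, ← mul_assoc, mul_one_div_cancel hn'.ne', one_mul, sum_tail_eq hσ q]
    have h1 : ∀ p : Fin n × Fin n, (min |x p.1 p.2| a) ^ q =
        (if (σ.symm p : ℕ) < n then a ^ q else 0) +
          if n ≤ (σ.symm p : ℕ) then |x p.1 p.2| ^ q else 0 := by
      intro p
      obtain ⟨k, rfl⟩ := σ.surjective p
      rw [Equiv.symm_apply_apply]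
      by_cases hk : (k : ℕ) < n
      · rw [if_pos hk, if_neg (by omega), add_zero, min_eq_right]
        exact hanti (show k ≤ ⟨n - 1, hlt⟩ from Fin.le_def.2 (by simp; omega))
      · rw [if_neg hk, if_pos (by omega), zero_add, min_eq_left]
        exact hanti (show (⟨n - 1, hlt⟩ : Fin (n ^ 2)) ≤ k from Fin.le_def.2 (by simp; omega))
    rw [Finset.sum_congr rfl fun p _ => h1 p, Finset.sum_add_distrib, ← σ.sum_comp]
    congr 1
    simp only [Equiv.symm_apply_apply]
    rw [← Finset.sum_filter, Finset.sum_const, nsmul_eq_mul]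
    congr 2
    rw [Fin.card_filter_val_lt, min_eq_right (by nlinarith)]
  have h2 := le_sum_perm_rpow hn (w := fun i j => (min |x i j| a) ^ q) (K := a ^ q)
    (fun i j => Real.rpow_nonneg (le_min (abs_nonneg _) ha0) _)
    (fun i j => Real.rpow_le_rpow (le_min (abs_nonneg _) ha0) (min_le_right _ _) hq0.le)
    hsum (by linarith) hq
  have h3 : n ! * (tailTerm q x / 4) ≤ ∑ π : Equiv.Perm (Fin n), diagNorm q x π := by
    refine le_trans ?_ (h2.trans ?_)
    · rw [tailTerm]
      gcongr
      linarith
    · refine Finset.sum_le_sum fun π _ => ?_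
      refine Real.rpow_le_rpow (Finset.sum_nonneg fun i _ =>
        Real.rpow_nonneg (le_min (abs_nonneg _) ha0) _) ?_ (by positivity)
      exact Finset.sum_le_sum fun i _ =>
        Real.rpow_le_rpow (le_min (abs_nonneg _) ha0) (min_le_left _ _) hq0.le
  have h4 := E.ofReal_mean_mul_nrm_one_le n.factorial_pos
    (w := fun k => if h : k < n ! then diagNorm q x (ℓ.symm ⟨k, h⟩) else 0)
    (fun k => by split_ifs; exacts [diagNorm_nonneg _ _ _, le_rfl])
  rw [sum_range_permFun ℓ (diagNorm q x)] at h4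
  have hf : (0 : ℝ) < (n ! : ℝ) := by positivity
  have h5 : tailTerm q x ≤ 4 * ((∑ π, diagNorm q x π) / n !) := by
    rw [mul_div_assoc', le_div_iff₀ hf]
    linarith
  rw [opT_eq_permFun]
  calc ENNReal.ofReal (tailTerm q x) * E.nrm 1
      ≤ ENNReal.ofReal (4 * ((∑ π, diagNorm q x π) / n !)) * E.nrm 1 := by gcongr
    _ = 4 * (ENNReal.ofReal ((∑ π, diagNorm q x π) / n !) * E.nrm 1) := by
        rw [ENNReal.ofReal_mul (by norm_num), mul_assoc]
        norm_num
    _ ≤ _ := by gcongr; exact h4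

end RISpace

/-! ### Restricting a matrix to a set of positions; diagonal matrices -/

section DiagonalEntries

variable {n : ℕ}

/-- The matrix `x` with the entries outside `A` replaced by `0`. -/
def restrictEntries (A : Finset (Fin n × Fin n)) (x : Matrix (Fin n) (Fin n) ℝ) :
    Matrix (Fin n) (Fin n) ℝ := fun i j => if (i, j) ∈ A then x i j else 0

theorem sum_restrictEntries {A : Finset (Fin n × Fin n)} {x : Matrix (Fin n) (Fin n) ℝ} {q : ℝ}
    (hq : 0 < q) (π : Equiv.Perm (Fin n)) :
    ∑ i, |restrictEntries A x i (π i)| ^ q = ∑ p ∈ A with π p.1 = p.2, |x p.1 p.2| ^ q := by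
  refine (Finset.sum_of_injOn Prod.fst ?_ (fun _ _ => Finset.mem_coe.2 (Finset.mem_univ _))
    ?_ ?_).symm
  · intro p hp r hr h
    have h1 := (Finset.mem_filter.1 hp).2
    have h2 := (Finset.mem_filter.1 hr).2
    exact Prod.ext h (by rw [← h1, ← h2, h])
  · intro i _ hi
    have : (i, π i) ∉ A := fun h => hi ⟨(i, π i), by simpa using h, rfl⟩
    rw [restrictEntries, if_neg this, abs_zero, Real.zero_rpow hq.ne']
  · intro p hp
    obtain ⟨h1, h2⟩ := Finset.mem_filter.1 hp
    rw [h2, restrictEntries, if_pos h1]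

theorem sum_diagonal_rpow {S : Finset (Fin n)} {d : Fin n → ℝ} (hd : ∀ i ∉ S, d i = 0) {q : ℝ}
    (hq : 0 < q) (π : Equiv.Perm (Fin n)) :
    ∑ i, |Matrix.diagonal d i (π i)| ^ q = ∑ i ∈ S with π i = i, |d i| ^ q := by
  rw [Finset.sum_filter, ← Finset.sum_subset (Finset.subset_univ S)]
  · refine Finset.sum_congr rfl fun i _ => ?_
    split_ifs with h
    · rw [h, Matrix.diagonal_apply_eq]
    · rw [Matrix.diagonal_apply_ne _ (Ne.symm h), abs_zero, Real.zero_rpow hq.ne']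
  · intro i _ hi
    by_cases h : i = π i
    · rw [← h, Matrix.diagonal_apply_eq, hd i hi, abs_zero, Real.zero_rpow hq.ne']
    · rw [Matrix.diagonal_apply_ne _ h, abs_zero, Real.zero_rpow hq.ne']

theorem exists_injOn_fin_of_card_le (hn : 0 < n) (A : Finset (Fin n × Fin n)) (hA : A.card ≤ n) :
    ∃ e : Fin n × Fin n → Fin n, Set.InjOn e A := by
  refine ⟨fun p => if h : p ∈ A then Fin.castLE hA (A.equivFin ⟨p, h⟩) else ⟨0, hn⟩, ?_⟩
  intro p hp r hr h
  rw [Finset.mem_coe] at hp hr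
  simp only [dif_pos hp, dif_pos hr] at h
  have := A.equivFin.injective (Fin.castLE_injective hA h)
  exact congrArg Subtype.val this

theorem tailTerm_of_isDiag {q : ℝ} (hq : 0 < q) {y : Matrix (Fin n) (Fin n) ℝ} (hy : y.IsDiag) :
    tailTerm q y = 0 := by
  have hc : (Finset.univ.filter fun p : Fin n × Fin n => 0 < |y p.1 p.2|).card ≤ n := by
    have : (Finset.univ.filter fun p : Fin n × Fin n => 0 < |y p.1 p.2|) ⊆
        Finset.univ.image fun i : Fin n => (i, i) := by
      intro p hp
      simp only [Finset.mem_filter, Finset.mem_univ, true_and, abs_pos] at hp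
      refine Finset.mem_image.2 ⟨p.1, Finset.mem_univ _, Prod.ext rfl ?_⟩
      by_contra h
      exact hp (hy h)
    exact (Finset.card_le_card this).trans (Finset.card_image_le.trans (by simp))
  have h0 : ∀ k ∈ Finset.Icc (n + 1) (n ^ 2), entryRearr y k ^ q = 0 := by
    intro k hk
    obtain ⟨h1, h2⟩ := Finset.mem_Icc.1 hk
    obtain ⟨m, rfl⟩ : ∃ m, k = m + 1 := ⟨k - 1, by omega⟩
    have h3 := (lt_card_iff_lt_entryRearr y 0 (k := m) (by omega)).not.1 (by omega)
    rw [le_antisymm (not_lt.1 h3) (entryRearr_nonneg _ _), Real.zero_rpow hq.ne']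
  rw [tailTerm, Finset.sum_eq_zero h0, mul_zero, Real.zero_rpow (by positivity)]

end DiagonalEntries

/-! ### The upper estimate from the diagonal case -/

namespace RISpace

variable (E : RISpace) {n : ℕ}

/-- Move the entries in `A` injectively onto the diagonal: this does not increase `U`, and the
distribution function of `T_q` drops by a factor of at most three. -/
theorem nrm_opT_restrictEntries_le (hn : 2 ≤ n) (ℓ : Equiv.Perm (Fin n) ≃ Fin n !) {q : ℝ}
    (hq : 1 ≤ q) {C : ℝ≥0∞}
    (hC : ∀ y : Matrix (Fin n) (Fin n) ℝ, y.IsDiag → E.nrm (opT ℓ q y) ≤ C * E.nrm (opU y))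
    (x : Matrix (Fin n) (Fin n) ℝ) {A : Finset (Fin n × Fin n)} (hA : 2 * A.card ≤ n + 1) :
    E.nrm (opT ℓ q (restrictEntries A x)) ≤ 3 * (C * E.nrm (opU x)) := by
  classical
  have hq0 : 0 < q := by linarith
  obtain ⟨e, he⟩ := exists_injOn_fin_of_card_le (by omega) A (by omega)
  -- Since `e` is injective on `A`, each sum has at most one term; off the image of `A` it is empty,
  -- so `d` is zero there.
  set d : Fin n → ℝ := fun i => ∑ p ∈ A with e p = i, x p.1 p.2 with hd
  have hde : ∀ p ∈ A, d (e p) = x p.1 p.2 := by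
    intro p hp
    simp only [hd]
    rw [Finset.sum_eq_single p]
    · intro r hr hrp
      exact absurd (he (Finset.mem_filter.1 hr).1 hp (Finset.mem_filter.1 hr).2) hrp
    · intro h
      exact absurd (Finset.mem_filter (p := fun r => e r = e p).2 ⟨hp, rfl⟩) h
  have hd0 : ∀ i ∉ A.image e, d i = 0 := by
    intro i hi
    refine Finset.sum_eq_zero fun p hp => ?_
    obtain ⟨h1, h2⟩ := Finset.mem_filter.1 hp
    exact absurd (Finset.mem_image.2 ⟨p, h1, h2⟩) hi
  have hdiag : ∀ π : Equiv.Perm (Fin n), ∑ i, |Matrix.diagonal d i (π i)| ^ q =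
      ∑ p ∈ A with π (e p) = e p, |x p.1 p.2| ^ q := by
    intro π
    rw [sum_diagonal_rpow hd0 hq0, Finset.sum_filter, Finset.sum_image he, Finset.sum_filter]
    exact Finset.sum_congr rfl fun p hp => by rw [hde p hp]
  have hpow : ∀ (s a : ℝ), 0 ≤ s → 0 ≤ a → (s < a ^ (1 / q) ↔ s ^ q < a) := by
    intro s a hs ha
    rw [one_div, Real.lt_rpow_inv_iff_of_pos hs ha hq0]
  have hU : E.nrm (opU (Matrix.diagonal d)) ≤ E.nrm (opU x) := by
    refine E.nrm_opU_le_of_card_le (by omega) fun s hs => ?_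
    refine le_trans (Finset.card_le_card (t := (A.filter fun p => s < |x p.1 p.2|).image
      fun p => (e p, e p)) ?_) (Finset.card_image_le.trans
        (Finset.card_le_card (Finset.filter_subset_filter _ (Finset.subset_univ _))))
    rintro ⟨i, j⟩ hij
    simp only [Finset.mem_filter, Finset.mem_univ, true_and] at hij
    by_cases h : i = j
    · subst h
      rw [Matrix.diagonal_apply_eq] at hij
      by_cases hi : i ∈ A.image e
      · obtain ⟨p, hp, rfl⟩ := Finset.mem_image.1 hi
        rw [hde p hp] at hij
        exact Finset.mem_image.2 ⟨p, Finset.mem_filter.2 ⟨hp, hij⟩, rfl⟩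
      · rw [hd0 i hi, abs_zero] at hij
        exact absurd hij (not_lt.2 hs)
    · rw [Matrix.diagonal_apply_ne _ h, abs_zero] at hij
      exact absurd hij (not_lt.2 hs)
  refine le_trans ?_ (mul_le_mul_right
    ((hC _ (Matrix.isDiag_diagonal d)).trans (mul_le_mul_right hU C)) 3)
  rw [opT_eq_permFun, opT_eq_permFun]
  refine E.nrm_permFun_le_mul ℓ (c := 3) (by norm_num) fun s hs => ?_
  simp only [abs_of_nonneg (diagNorm_nonneg _ _ _)]
  have hcond1 : ∀ π : Equiv.Perm (Fin n), s < diagNorm q (restrictEntries A x) π ↔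
      s ^ q < ∑ p ∈ A with π p.1 = p.2, |x p.1 p.2| ^ q := by
    intro π
    rw [diagNorm, sum_restrictEntries hq0, hpow _ _ hs
      (Finset.sum_nonneg fun _ _ => Real.rpow_nonneg (abs_nonneg _) _)]
  have hcond2 : ∀ π : Equiv.Perm (Fin n), s < diagNorm q (Matrix.diagonal d) π ↔
      s ^ q < ∑ p ∈ A with π (e p) = e p, |x p.1 p.2| ^ q := by
    intro π
    rw [diagNorm, hdiag, hpow _ _ hs
      (Finset.sum_nonneg fun _ _ => Real.rpow_nonneg (abs_nonneg _) _)]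
  simp only [hcond1, hcond2]
  exact card_perm_hit_sum_le hn hA he (fun p => |x p.1 p.2| ^ q) (s ^ q)

theorem nrm_opU_le_of_abs_le (hn : 0 < n) {a : ℝ} {x : Matrix (Fin n) (Fin n) ℝ}
    (hx : ∀ i j, |x i j| ≤ a) : E.nrm (opU x) ≤ ENNReal.ofReal a * E.nrm 1 := by
  have ha : 0 ≤ a := (abs_nonneg _).trans (hx ⟨0, hn⟩ ⟨0, hn⟩)
  rw [opU_eq_stepFun hn, ← Real.enorm_of_nonneg ha, ← stepFun_one n, ← E.nrm_smul, ← stepFun_smul]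
  refine E.nrm_stepFun_mono hn fun k hk => ?_
  obtain ⟨σ, _, hσ⟩ := exists_entryRearr_equiv x
  rw [hσ ⟨k, by nlinarith⟩]
  simpa [abs_of_nonneg ha] using hx _ _

theorem ofReal_mul_nrm_one_le_nrm_opU (hn : 0 < n) {a : ℝ} {x : Matrix (Fin n) (Fin n) ℝ}
    (ha : 0 ≤ a) (hx : ∀ k < n, a ≤ entryRearr x (k + 1)) :
    ENNReal.ofReal a * E.nrm 1 ≤ E.nrm (opU x) := by
  rw [opU_eq_stepFun hn, ← Real.enorm_of_nonneg ha, ← stepFun_one n, ← E.nrm_smul, ← stepFun_smul]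
  refine E.nrm_stepFun_mono hn fun k hk => ?_
  rw [abs_of_nonneg (entryRearr_nonneg _ _)]
  simpa [abs_of_nonneg ha] using hx k hk

/-- Up to constants, `T_q z` is dominated in distribution by `T_q y + 1`, where `y` is a 0-1
diagonal matrix with about `n / 2` ones, so that `T_q y` is the `1/q`-th power of a number of fixed
points. -/
theorem nrm_opT_le_of_abs_le_one (hn : 2 ≤ n) (ℓ : Equiv.Perm (Fin n) ≃ Fin n !) {q : ℝ}
    (hq : 1 ≤ q) {C : ℝ≥0∞}
    (hC : ∀ y : Matrix (Fin n) (Fin n) ℝ, y.IsDiag → E.nrm (opT ℓ q y) ≤ C * E.nrm (opU y))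
    {z : Matrix (Fin n) (Fin n) ℝ} (hz : ∀ i j, |z i j| ≤ 1)
    (hsum : ∑ i, ∑ j, |z i j| ^ q ≤ n) :
    E.nrm (opT ℓ q z) ≤ 3 * (5 * (C * E.nrm 1 + E.nrm 1)) := by
  have hq0 : 0 < q := by linarith
  have hq1 : 1 / q ≤ 1 := by rw [div_le_one hq0]; exact hq
  -- The size `⌊(n + 1) / 2⌋` meets both constraints `n ≤ 2 * S.card ≤ n + 1` of the tail
  -- comparison.
  obtain ⟨S, -, hS⟩ := Finset.exists_subset_card_eq
    (s := (Finset.univ : Finset (Fin n))) (n := (n + 1) / 2) (by simp; omega)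
  set d : Fin n → ℝ := fun i => if i ∈ S then 1 else 0 with hd
  have hN : ∀ π : Equiv.Perm (Fin n), diagNorm q (Matrix.diagonal d) π =
      ((S.filter fun i => π i = i).card : ℝ) ^ (1 / q) := by
    intro π
    rw [diagNorm, sum_diagonal_rpow (S := S) (by simp +contextual [hd]) hq0]
    congr 1
    rw [Finset.sum_congr rfl fun i hi => show |d i| ^ q = 1 by
      simp [hd, (Finset.mem_filter.1 hi).1]]
    simp
  have hU : E.nrm (opU (Matrix.diagonal d)) ≤ E.nrm 1 := by
    refine (E.nrm_opU_le_of_abs_le (a := 1) (by omega) fun i j => ?_).trans (by simp)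
    rw [Matrix.diagonal_apply]
    simp only [hd]
    split_ifs <;> simp
  have h5 : E.nrm (permFun ℓ ((5 : ℝ) • (diagNorm q (Matrix.diagonal d) + 1))) ≤
      5 * (C * E.nrm 1 + E.nrm 1) := by
    rw [permFun_smul, E.nrm_smul, permFun_add, ← opT_eq_permFun]
    have : ‖(5 : ℝ)‖ₑ = 5 := by
      rw [Real.enorm_of_nonneg (by norm_num)]
      norm_num
    rw [this]
    refine mul_le_mul_right ((E.nrm_add_le _ _).trans (add_le_add ?_ (E.nrm_permFun_one_le ℓ))) 5
    exact (hC _ (Matrix.isDiag_diagonal d)).trans (mul_le_mul_right hU C)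
  refine le_trans ?_ (mul_le_mul_right h5 3)
  rw [opT_eq_permFun]
  refine E.nrm_permFun_le_mul ℓ (c := 3) (by norm_num) fun s hs => ?_
  have hsq : 0 ≤ s ^ q := Real.rpow_nonneg hs q
  -- The tail comparison is for integer thresholds `5k`. Rounding `s ^ q / 5` down loses less than
  -- one fixed point, which the added constant `1` absorbs.
  have h1 := card_perm_sum_ge_le hn (w := fun i j => |z i j| ^ q)
    (fun i j => Real.rpow_nonneg (abs_nonneg _) _)
    (fun i j => Real.rpow_le_one (abs_nonneg _) (hz i j) hq0.le) hsum (S := S) (by omega)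
    (by omega) ⌊s ^ q / 5⌋₊
  refine le_trans (Finset.card_le_card fun π hπ => ?_)
    (h1.trans (Nat.mul_le_mul_left 3 (Finset.card_le_card fun π hπ => ?_)))
  · simp only [Finset.mem_filter, Finset.mem_univ, true_and] at hπ ⊢
    rw [abs_of_nonneg (diagNorm_nonneg _ _ _), diagNorm, one_div, Real.lt_rpow_inv_iff_of_pos hs
      (Finset.sum_nonneg fun _ _ => Real.rpow_nonneg (abs_nonneg _) _) hq0] at hπ
    have := Nat.floor_le (a := s ^ q / 5) (by positivity)
    linarith
  · simp only [Finset.mem_filter, Finset.mem_univ, true_and] at hπ ⊢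
    have h2 := Nat.lt_of_floor_lt (Nat.lt_succ_of_le hπ)
    push_cast at h2
    set N : ℝ := ((S.filter fun i => π i = i).card : ℝ) with hNdef
    have hN0 : 0 ≤ N := Nat.cast_nonneg _
    have h3 : s < (5 * (N + 1)) ^ (1 / q) := by
      rw [one_div, Real.lt_rpow_inv_iff_of_pos hs (by positivity) hq0]
      linarith
    have h4 : (5 * (N + 1)) ^ (1 / q) ≤ 5 * (N ^ (1 / q) + 1) := by
      rw [Real.mul_rpow (by norm_num) (by positivity)]
      have h6 : (5 : ℝ) ^ (1 / q) ≤ 5 := by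
        simpa using Real.rpow_le_rpow_of_exponent_le (x := (5 : ℝ)) (by norm_num) hq1
      have h7 : (N + 1) ^ (1 / q) ≤ N ^ (1 / q) + 1 := by
        obtain ⟨M, hM⟩ : ∃ M : ℝ≥0, (M : ℝ) = N := ⟨⟨N, hN0⟩, rfl⟩
        have := NNReal.rpow_add_le_add_rpow M 1 (by positivity : 0 ≤ 1 / q) hq1
        rw [NNReal.one_rpow] at this
        rw [← hM]
        exact_mod_cast this
      gcongr
    have h8 : 0 ≤ N ^ (1 / q) := Real.rpow_nonneg hN0 _
    simp only [Pi.smul_apply, Pi.add_apply, Pi.one_apply, smul_eq_mul, hN]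
    rw [abs_of_nonneg (by positivity)]
    exact h3.trans_le h4

theorem nrm_opT_le_of_abs_le (hn : 2 ≤ n) (ℓ : Equiv.Perm (Fin n) ≃ Fin n !) {q : ℝ}
    (hq : 1 ≤ q) {C : ℝ≥0∞}
    (hC : ∀ y : Matrix (Fin n) (Fin n) ℝ, y.IsDiag → E.nrm (opT ℓ q y) ≤ C * E.nrm (opU y))
    {z : Matrix (Fin n) (Fin n) ℝ} {K : ℝ} (hz : ∀ i j, |z i j| ≤ K)
    (hsum : ∑ i, ∑ j, |z i j| ^ q ≤ n * K ^ q) :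
    E.nrm (opT ℓ q z) ≤ ENNReal.ofReal K * (3 * (5 * (C * E.nrm 1 + E.nrm 1))) := by
  have hq0 : 0 < q := by linarith
  have hK : 0 ≤ K := (abs_nonneg _).trans (hz ⟨0, by omega⟩ ⟨0, by omega⟩)
  have hzK : z = K • (K⁻¹ • z) := by
    rcases hK.eq_or_lt with h | h
    · ext i j
      have := hz i j
      rw [← h] at this ⊢
      simpa using abs_nonpos_iff.1 this
    · rw [smul_smul, mul_inv_cancel₀ h.ne', one_smul]
  rw [hzK, E.nrm_opT_smul ℓ hq, Real.enorm_of_nonneg hK]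
  refine mul_le_mul_right (E.nrm_opT_le_of_abs_le_one hn ℓ hq hC (fun i j => ?_) ?_) _
  · rw [Matrix.smul_apply, smul_eq_mul, abs_mul, abs_inv, abs_of_nonneg hK]
    exact inv_mul_le_one_of_le₀ (hz i j) hK
  · simp only [Matrix.smul_apply, smul_eq_mul, abs_mul, abs_inv, abs_of_nonneg hK]
    simp_rw [Real.mul_rpow (inv_nonneg.2 hK) (abs_nonneg _), ← Finset.mul_sum]
    rw [Real.inv_rpow hK]
    exact inv_mul_le_of_le_mul₀ (Real.rpow_nonneg hK _) (Nat.cast_nonneg _)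
      (by rwa [mul_comm])

/-- The blocks are the ranks below `⌊(n + 1) / 2⌋`, from there up to `n`, and from `n` on. The top
`n` need two blocks because moving entries to the diagonal allows only about `n / 2` at a time. -/
theorem nrm_opT_le_of_diagonal (hn : 2 ≤ n) (ℓ : Equiv.Perm (Fin n) ≃ Fin n !) {q : ℝ}
    (hq : 1 ≤ q) {C : ℝ≥0∞}
    (hC : ∀ y : Matrix (Fin n) (Fin n) ℝ, y.IsDiag → E.nrm (opT ℓ q y) ≤ C * E.nrm (opU y))
    (x : Matrix (Fin n) (Fin n) ℝ) :
    E.nrm (opT ℓ q x) ≤ (21 * C + 15 + 15 * (C * E.nrm 1 + E.nrm 1)) *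
      (E.nrm (opU x) + ENNReal.ofReal (tailTerm q x)) := by
  obtain ⟨σ, hanti, hσ⟩ := exists_entryRearr_equiv x
  have hq0 : 0 < q := by linarith
  have hn' : (0 : ℝ) < n := by positivity
  have hlt : n - 1 < n ^ 2 := by
    have : n ≤ n ^ 2 := by nlinarith
    omega
  set a : ℝ := |x (σ ⟨n - 1, hlt⟩).1 (σ ⟨n - 1, hlt⟩).2| with ha
  have ha0 : 0 ≤ a := abs_nonneg _
  set m := (n + 1) / 2 with hm
  let r : Fin n × Fin n → ℕ := fun p => (σ.symm p : ℕ)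
  have hr : ∀ p s, r p = r s → p = s := fun p s h => σ.symm.injective (Fin.ext h)
  set A₁ := Finset.univ.filter fun p => r p < m with hA₁
  set A₂ := Finset.univ.filter fun p => m ≤ r p ∧ r p < n with hA₂
  set A₃ := Finset.univ.filter fun p => n ≤ r p with hA₃
  have hsplit : x = restrictEntries A₁ x + (restrictEntries A₂ x + restrictEntries A₃ x) := by
    ext i j
    simp only [Matrix.add_apply, restrictEntries, hA₁, hA₂, hA₃, Finset.mem_filter,
      Finset.mem_univ, true_and]
    by_cases h1 : r (i, j) < m
    · rw [if_pos h1, if_neg (by omega), if_neg (by omega)]; simp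
    · by_cases h2 : r (i, j) < n
      · rw [if_neg h1, if_pos (by omega), if_neg (by omega)]; simp
      · rw [if_neg h1, if_neg (by omega), if_pos (by omega)]; simp
  have hc₁ : A₁.card ≤ m := by
    have := Finset.card_le_card_of_injOn r (s := A₁) (t := Finset.range m)
      (fun p hp => by simpa [hA₁] using hp) (fun p _ s _ => hr p s)
    simpa using this
  have hc₂ : A₂.card ≤ n - m := by
    have := Finset.card_le_card_of_injOn r (s := A₂) (t := Finset.Ico m n)
      (fun p hp => by simpa [hA₂] using hp) (fun p _ s _ => hr p s)
    simpa using this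
  have h1 := E.nrm_opT_restrictEntries_le hn ℓ hq hC x (A := A₁) (by omega)
  have h2 := E.nrm_opT_restrictEntries_le hn ℓ hq hC x (A := A₂) (by omega)
  have htail0 : 0 ≤ tailTerm q x := Real.rpow_nonneg (mul_nonneg (by positivity)
    (Finset.sum_nonneg fun k _ => Real.rpow_nonneg (entryRearr_nonneg x k) _)) _
  -- In `K`, the summand `a = x_n^*` dominates each remaining entry, and the tail term accounts for
  -- their `q`-sum.
  have h3 := E.nrm_opT_le_of_abs_le hn ℓ hq hC (z := restrictEntries A₃ x)
    (K := a + tailTerm q x) (fun i j => by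
      rw [restrictEntries]
      split_ifs with h
      · have hle : n ≤ r (i, j) := by simpa [hA₃] using h
        have h4 := hanti (show (⟨n - 1, hlt⟩ : Fin (n ^ 2)) ≤ σ.symm (i, j) from
          Fin.le_def.2 (show n - 1 ≤ r (i, j) by omega))
        simp only [Equiv.apply_symm_apply] at h4
        linarith
      · rw [abs_zero]
        linarith)
    (by
      have h4 : ∑ i, ∑ j, |restrictEntries A₃ x i j| ^ q =
          ∑ k ∈ Finset.Icc (n + 1) (n ^ 2), entryRearr x k ^ q := by
        rw [sum_tail_eq hσ q, ← Finset.sum_product' (f := fun i j => |restrictEntries A₃ x i j| ^ q),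
          Finset.univ_product_univ]
        refine Finset.sum_congr rfl fun p _ => ?_
        simp only [restrictEntries, hA₃, Finset.mem_filter, Finset.mem_univ, true_and]
        split_ifs
        · rfl
        · rw [abs_zero, Real.zero_rpow hq0.ne']
      have h5 : n * tailTerm q x ^ q = ∑ k ∈ Finset.Icc (n + 1) (n ^ 2), entryRearr x k ^ q := by
        rw [tailTerm, ← Real.rpow_mul (mul_nonneg (by positivity) (Finset.sum_nonneg fun k _ =>
          Real.rpow_nonneg (entryRearr_nonneg x k) _)), one_div_mul_cancel hq0.ne', Real.rpow_one,
          ← mul_assoc, mul_one_div_cancel hn'.ne', one_mul]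
      rw [h4, ← h5]
      have : tailTerm q x ^ q ≤ (a + tailTerm q x) ^ q :=
        Real.rpow_le_rpow htail0 (by linarith) hq0.le
      gcongr)
  -- The part of `K` due to `a` is absorbed by `U x`, all of whose `n` steps are at least `a`.
  have h6 : ENNReal.ofReal a * E.nrm 1 ≤ E.nrm (opU x) := by
    refine E.ofReal_mul_nrm_one_le_nrm_opU (by omega) ha0 fun k hk => ?_
    have hk2 : k < n ^ 2 := by nlinarith
    rw [hσ ⟨k, hk2⟩]
    exact hanti (show (⟨k, hk2⟩ : Fin (n ^ 2)) ≤ ⟨n - 1, hlt⟩ from Fin.le_def.2 (by simp; omega))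
  rw [ENNReal.ofReal_add ha0 htail0] at h3
  have h7 : E.nrm (opT ℓ q x) ≤ 3 * (C * E.nrm (opU x)) + (3 * (C * E.nrm (opU x)) +
      (ENNReal.ofReal a + ENNReal.ofReal (tailTerm q x)) *
        (3 * (5 * (C * E.nrm 1 + E.nrm 1)))) := by
    conv_lhs => rw [hsplit]
    exact (E.nrm_opT_add_le ℓ hq _ _).trans (add_le_add h1
      ((E.nrm_opT_add_le ℓ hq _ _).trans (add_le_add h2 h3)))
  refine h7.trans ?_
  generalize E.nrm (opU x) = u at *
  generalize ENNReal.ofReal (tailTerm q x) = t at *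
  generalize ENNReal.ofReal a = b at *
  generalize E.nrm 1 = o at *
  calc _ = 6 * C * u + 15 * (C + 1) * (b * o) + 15 * (C * o + o) * t := by ring
    _ ≤ 6 * C * u + 15 * (C + 1) * u + 15 * (C * o + o) * t := by gcongr
    -- Nonnegative cross terms are added only so that the bound factors as a constant times `u + t`.
    _ ≤ 6 * C * u + 15 * (C + 1) * u + 15 * (C * o + o) * t +
        (15 * (C * o + o) * u + (21 * C + 15) * t) := le_self_add
    _ = _ := by ring

end RISpace

/-! ### The equivalence -/

theorem corollary8 (E : RISpace) (q : ℝ) (hq : 1 ≤ q)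
    (ℓ : (n : ℕ) → (Equiv.Perm (Fin n) ≃ Fin n !)) :
    (∃ c C : ℝ≥0, 0 < c ∧ ∀ n : ℕ, 1 ≤ n → ∀ x : Matrix (Fin n) (Fin n) ℝ,
        (c : ℝ≥0∞) * (E.nrm (opU x) + ENNReal.ofReal (tailTerm q x)) ≤ E.nrm (opT (ℓ n) q x) ∧
        E.nrm (opT (ℓ n) q x) ≤
          (C : ℝ≥0∞) * (E.nrm (opU x) + ENNReal.ofReal (tailTerm q x))) ↔
      (∃ C : ℝ≥0, ∀ n : ℕ, 1 ≤ n → ∀ y : Matrix (Fin n) (Fin n) ℝ, y.IsDiag →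
        E.nrm (opT (ℓ n) q y) ≤ (C : ℝ≥0∞) * E.nrm (opU y)) := by
  constructor
  · rintro ⟨c, C, _, h⟩
    refine ⟨C, fun n hn y hy => ?_⟩
    simpa [tailTerm_of_isDiag (show 0 < q by linarith) hy] using (h n hn y).2
  · rintro ⟨C, h⟩
    obtain ⟨o, ho⟩ : ∃ o : ℝ≥0, (o : ℝ≥0∞) = E.nrm 1 :=
      ⟨(E.nrm 1).toNNReal, ENNReal.coe_toNNReal E.nrm_one_lt_top.ne⟩
    have ho0 : 0 < o := by
      rw [← ENNReal.coe_pos, ho]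
      exact pos_iff_ne_zero.2 E.nrm_one_ne_zero
    -- The `8` is `4 + 4` from the two lower bounds; `min 1 o` compensates for the norm `o` of the
    -- constant `1`, which multiplies the tail term in the second.
    refine ⟨min 1 o / 8, 21 * C + 15 + 15 * (C * o + o), by positivity, fun n hn x => ⟨?_, ?_⟩⟩
    · have h1 := E.nrm_opU_le_nrm_opT hn (ℓ n) hq x
      have h2 := E.ofReal_tailTerm_mul_le hn (ℓ n) hq x
      rw [← ho] at h2
      have h3 : ((min 1 o / 8 : ℝ≥0) : ℝ≥0∞) = ((min 1 o : ℝ≥0) : ℝ≥0∞) / 8 := by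
        rw [ENNReal.coe_div (by norm_num)]
        rfl
      rw [h3, ← ENNReal.mul_div_right_comm]
      refine ENNReal.div_le_of_le_mul' ?_
      have hm1 : ((min 1 o : ℝ≥0) : ℝ≥0∞) ≤ 1 := by exact_mod_cast min_le_left 1 o
      have hm2 : ((min 1 o : ℝ≥0) : ℝ≥0∞) ≤ o := by exact_mod_cast min_le_right 1 o
      calc ((min 1 o : ℝ≥0) : ℝ≥0∞) * (E.nrm (opU x) + ENNReal.ofReal (tailTerm q x))
          ≤ 1 * E.nrm (opU x) + ENNReal.ofReal (tailTerm q x) * o := by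
            rw [mul_add, mul_comm (ENNReal.ofReal _)]
            gcongr
        _ ≤ 4 * E.nrm (opT (ℓ n) q x) + 4 * E.nrm (opT (ℓ n) q x) := by
            rw [one_mul]
            exact add_le_add h1 h2
        _ = 8 * E.nrm (opT (ℓ n) q x) := by ring
    · push_cast
      rw [ho]
      -- The bound on permutations with exactly prescribed fixed points needs `n ≥ 2`; for `n = 1`
      -- every matrix is diagonal.
      rcases hn.eq_or_lt with rfl | hn2
      · have hx : x.IsDiag := fun i j hij => absurd (Subsingleton.elim i j) hij
        refine (h 1 le_rfl x hx).trans (mul_le_mul' ?_ le_self_add)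
        calc (C : ℝ≥0∞) ≤ C + (20 * C + 15 + 15 * (C * E.nrm 1 + E.nrm 1)) := le_self_add
          _ = _ := by ring
      · exact E.nrm_opT_le_of_diagonal hn2 (ℓ n) hq (h n hn) x
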